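/- **Trees.** A marked tree $\mathbf t^*=(\mathbf t,(\eta_u)_{u\in\mathbf t})$ is a rooted ordered tree $\mathbf t$ with finite out-degrees $k_u$ (Neveu's formalism), possibly infinite, in which each vertex carries a mark $\eta_u\in\{0,1\}$. Let $z_n$ be the set of vertices of generation $n$, $Z_n=\#z_n$, $M_n=\sum_{|u|\le n-1}\eta_u$ ($M_0=0$), and let $M_\infty$ be the total number of marked vertices. The restriction $r_n^*(\mathbf t^*)$ keeps the vertices of generations $\le n$ and the marks of generations $\le n-1$ (vertices of generation $n$ get mark $0$). The space $\mathbb T^*$ of marked trees carries the $\sigma$-field $\mathscr F$ generated by the vertices and their marks, and $\mathscr F_n$ is the $\sigma$-field generated by $r_n^*$. The mass $m_u$ of a vertex is defined by $m_\emptyset=0$ and, for a child $uj$ of a vertex $u\in z_n$, $$m_{uj}=\frac{m_u+\eta_u}{k_u}+\frac{1}{Z_{n+1}}\sum_{w\in z_n,\ k_w=0}(m_w+\eta_w).$$ **Assumptions.** Let $\ell\ge 1$, let $\mathbf p$ be a probability distribution on $\mathbb N$ with $\mathbf p(0)+\mathbf p(1)<1$, mean $\sum_k k\,\mathbf p(k)<1$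 and $\sum_k k^\ell\mathbf p(k)<\infty$, and let $\mathbf q:\mathbb N\to[0,1]$ satisfy $\mathbf p(k)\mathbf q(k)>0$ for some $k$. Put $\mathbf p_0(k,1)=\mathbf p(k)\mathbf q(k)$, $\mathbf p_0(k,0)=\mathbf p(k)(1-\mathbf q(k))$. Let $\mathbb P$ (with expectation $\mathbb E$) be the law of the marked Galton–Watson tree in which the pairs $(k_u,\eta_u)$ are independent with law $\mathbf p_0$. Put $\xi_i=\mathbb E[M_\infty^i]$ and, for real $s\ge 0$ and integers $i,z\ge 0$, $$f_i(s,z)=\frac1{\xi_i}\sum_{j=0}^{i}\binom ij s^{i-j}\sum_{a_1+\dots+a_z=j}\binom{j}{a_1\cdots a_z}\prod_{b=1}^z\xi_{a_b}$$ (with $0^0=1$; thus $f_i(s,0)=s^i/\xi_i$ and $f_0=1$). **Weighted tree of type $\ell$.** This is a random marked tree whose vertices have types in $\{0,\dots,\ell\}$, built generation by generation as follows. The root has type $\ell$. Given the tree up to generation $n$ and the types of its vertices, the vertices of generation $n$ reproduce and are marked independently; a vertex of type $0$ has $k$ children and mark $\eta$ with probability $\mathbf p_0(k,\eta)$, and a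 vertex $u$ of type $i\in\{1,\dots,\ell\}$ has $k$ children and mark $\eta$ with probability $$\mathbf p_i(k,\eta)=\frac{\mathbf p_0(k,\eta)\,f_i(m_u+\eta,k)}{f_i(m_u,1)}.$$ Then, given all this and if generation $n+1$ is not empty, its vertices receive the types $(t_u)_{u\in z_{n+1}}$, where $\sum_{u\in z_{n+1}} t_u=\ell$, with probability $$\gamma=\frac{\ell!}{\prod_{u\in z_{n+1}}t_u!}\cdot\frac{\prod_{u\in z_{n+1}}f_{t_u}(m_u,1)\,\xi_{t_u}}{\xi_\ell\, f_\ell(M_{n+1},Z_{n+1})}.$$ **Theorem.** There is a unique probability measure $\mathbb Q_\ell$ on $(\mathbb T^*,\mathscr F)$ such that $$\mathbb Q_\ell(\Lambda)=\mathbb E\big[\mathbf 1_{\Lambda}\,f_\ell(M_n,Z_n)\big]\qquad\text{for all } n\in\mathbb N \text{ and } \Lambda\in\mathscr F_n .$$ Weighted trees of type $\ell$ exist, and every weighted tree of type $\ell$, on any probability space, has law $\mathbb Q_\ell$. -/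

import Mathlib

open MeasureTheory
open scoped ENNReal Nat BigOperators

/-- A marked rooted ordered tree in Neveu's formalism. A vertex is the finite word of the ranks of
its ancestors, the root is the empty word, and the children of `u` are the words `u ++ [i]`,
`i < k` (ranks start at `0`). The mark of a vertex is `true` (mark `1`) or `false` (mark `0`);
words that are not vertices get the value `false`, so that equality of marked trees is equality of
the trees and of the marks of their vertices. -/
@[ext]
structure MarkedTree where
  nodes : Set (List ℕ)
  mark : List ℕ → Bool
  nil_mem : [] ∈ nodes
  parent_mem : ∀ (u : List ℕ) (j : ℕ), u ++ [j] ∈ nodes → u ∈ nodes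
  children : ∀ u ∈ nodes, ∃ k : ℕ, ∀ i : ℕ, u ++ [i] ∈ nodes ↔ i < k
  mem_of_mark : ∀ u : List ℕ, mark u = true → u ∈ nodes

namespace MarkedTree

/-- The number `k_u` of children of `u`. -/
noncomputable def numChildren (t : MarkedTree) (u : List ℕ) : ℕ :=
  {i : ℕ | u ++ [i] ∈ t.nodes}.ncard

/-- The mark `η_u` as a number. -/
def eta (t : MarkedTree) (u : List ℕ) : ℕ := (t.mark u).toNat

theorem finite_level (t : MarkedTree) (n : ℕ) : {u | u ∈ t.nodes ∧ u.length = n}.Finite := by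
  induction n with
  | zero =>
    refine (Set.finite_singleton ([] : List ℕ)).subset ?_
    rintro u ⟨-, hu⟩
    exact List.length_eq_zero_iff.mp hu
  | succ n ih =>
    have hfin : ∀ u ∈ {u | u ∈ t.nodes ∧ u.length = n},
        ((fun i : ℕ => u ++ [i]) '' {i | u ++ [i] ∈ t.nodes}).Finite := by
      rintro u ⟨hu, -⟩
      obtain ⟨k, hk⟩ := t.children u hu
      exact ((Set.finite_Iio k).subset fun i hi => (hk i).mp hi).image _
    refine (ih.biUnion hfin).subset ?_
    rintro v ⟨hv, hlen⟩
    rcases List.eq_nil_or_concat' v with rfl | ⟨u, i, rfl⟩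
    · simp at hlen
    · simp only [Set.mem_iUnion]
      exact ⟨u, ⟨t.parent_mem u i hv, by simpa using hlen⟩, i, hv, rfl⟩

/-- The set `z_n` of vertices of generation `n`. -/
noncomputable def level (t : MarkedTree) (n : ℕ) : Finset (List ℕ) := (t.finite_level n).toFinset

/-- The size `Z_n` of generation `n`. -/
noncomputable def levelSize (t : MarkedTree) (n : ℕ) : ℕ := (t.level n).card

/-- The number `M_n` of marked vertices of generations `0, …, n - 1`. -/
noncomputable def numMarks (t : MarkedTree) (n : ℕ) : ℕ :=
  ∑ i ∈ Finset.range n, ∑ u ∈ t.level i, t.eta u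

/-- The total number of marked vertices, possibly infinite. -/
noncomputable def totalMarks (t : MarkedTree) : ℕ∞ := {u | t.mark u = true}.encard

/-- The masses of the vertices of generation `n`: at each step a vertex hands on its mass plus its
mark, uniformly to its children if it has some, uniformly to the whole next generation if not. -/
noncomputable def massAt (t : MarkedTree) : ℕ → List ℕ → ℝ
  | 0, _ => 0
  | n + 1, v =>
    (massAt t n v.dropLast + t.eta v.dropLast) / t.numChildren v.dropLast +
      (∑ w ∈ t.level n with t.numChildren w = 0, (massAt t n w + t.eta w)) / t.levelSize (n + 1)

/-- The mass `m_u` of the vertex `u`. -/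
noncomputable def mass (t : MarkedTree) (u : List ℕ) : ℝ := t.massAt u.length u

/-- The restriction `r_n^*`: vertices up to generation `n`, marks up to generation `n - 1`. -/
def restrict (n : ℕ) (t : MarkedTree) : MarkedTree where
  nodes := {u | u ∈ t.nodes ∧ u.length ≤ n}
  mark u := t.mark u && decide (u.length < n)
  nil_mem := ⟨t.nil_mem, Nat.zero_le n⟩
  parent_mem := by
    rintro u j ⟨h, hl⟩
    refine ⟨t.parent_mem u j h, ?_⟩
    rw [List.length_append] at hl
    omega
  children := by
    rintro u ⟨hu, -⟩
    obtain ⟨k, hk⟩ := t.children u hu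
    by_cases h : u.length + 1 ≤ n
    · exact ⟨k, fun i => by simp [hk i, h]⟩
    · exact ⟨0, fun i => by simp [h]⟩
  mem_of_mark := by
    intro u hu
    simp only [Bool.and_eq_true, decide_eq_true_eq] at hu
    exact ⟨t.mem_of_mark u hu.1, hu.2.le⟩

/-- The `σ`-field on marked trees generated by the vertices and their marks. -/
instance instMeasurableSpace : MeasurableSpace MarkedTree :=
  MeasurableSpace.generateFrom
    (Set.range (fun u : List ℕ => {t : MarkedTree | u ∈ t.nodes}) ∪
      Set.range (fun u : List ℕ => {t : MarkedTree | t.mark u = true}))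

/-- The `σ`-field `ℱ_n` generated by the restriction `r_n^*`. -/
abbrev filtration (n : ℕ) : MeasurableSpace MarkedTree :=
  MeasurableSpace.comap (restrict n) instMeasurableSpace

/-- The marked tree in which the vertex `u` has `(x u).1` children and the mark `(x u).2`. -/
noncomputable def ofFamily (x : List ℕ → ℕ × Bool) : MarkedTree where
  nodes := {u | ∀ (v : List ℕ) (i : ℕ), v ++ [i] <+: u → i < (x v).1}
  mark u := by
    classical
    exact (x u).2 && decide (∀ (v : List ℕ) (i : ℕ), v ++ [i] <+: u → i < (x v).1)
  nil_mem := by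
    intro v i h
    simp at h
  parent_mem := fun u j h v i hv => h v i (hv.trans (List.prefix_append u [j]))
  children := by
    intro u hu
    refine ⟨(x u).1, fun i => ⟨fun h => h u i (List.prefix_refl _), fun hi v j hv => ?_⟩⟩
    rcases List.prefix_concat_iff.mp hv with h | h
    · obtain ⟨rfl, h'⟩ := List.append_inj' h rfl
      obtain rfl : j = i := by simpa using h'
      exact hi
    · exact hu v j h
  mem_of_mark := by
    intro u hu
    simp only [Bool.and_eq_true, decide_eq_true_eq] at hu
    exact hu.2

end MarkedTree

/-- The reproduction-marking law `p₀` on `ℕ × {0, 1}` of an offspring distribution `p` and a mark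
function `q`: `p₀(k, 1) = p(k) q(k)` and `p₀(k, 0) = p(k) (1 - q(k))`. -/
noncomputable def reproMarkLaw (p : PMF ℕ) (q : ℕ → unitInterval) : PMF (ℕ × Bool) :=
  ⟨fun x => p x.1 * ENNReal.ofReal (if x.2 then (q x.1 : ℝ) else 1 - (q x.1 : ℝ)), by
    have h : ∑' x : ℕ × Bool,
        p x.1 * ENNReal.ofReal (if x.2 then (q x.1 : ℝ) else 1 - (q x.1 : ℝ)) = 1 := by
      rw [ENNReal.tsum_prod', ← p.tsum_coe]
      refine tsum_congr fun k => ?_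
      have hk : ENNReal.ofReal (1 - (q k : ℝ)) + ENNReal.ofReal (q k : ℝ) = 1 := by
        rw [← ENNReal.ofReal_add (sub_nonneg.mpr (q k).2.2) (q k).2.1]
        simp
      rw [tsum_bool]
      simp [← mul_add, hk]
    exact h ▸ ENNReal.summable.hasSum⟩

/-- The law of the marked Galton-Watson tree with reproduction-marking law `p₀`: the numbers of
children and the marks of the vertices are independent copies with law `p₀`. -/
noncomputable def markedGaltonWatson (p : PMF ℕ) (q : ℕ → unitInterval) : Measure MarkedTree :=
  (Measure.infinitePi fun _ : List ℕ => (reproMarkLaw p q).toMeasure).map MarkedTree.ofFamily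

/-- The moment `ξ_i` of order `i` of the total number of marks of the marked Galton-Watson tree. -/
noncomputable def xi (p : PMF ℕ) (q : ℕ → unitInterval) (i : ℕ) : ℝ :=
  (∫⁻ t, (t.totalMarks : ℝ≥0∞) ^ i ∂(markedGaltonWatson p q)).toReal

/-- The function `f_i(s, z)`. -/
noncomputable def weight (p : PMF ℕ) (q : ℕ → unitInterval) (i : ℕ) (s : ℝ) (z : ℕ) : ℝ :=
  1 / xi p q i * ∑ j ∈ Finset.range (i + 1), (i.choose j : ℝ) * s ^ (i - j) *
    ∑ a ∈ Finset.piAntidiag (Finset.univ : Finset (Fin z)) j,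
      (Nat.multinomial Finset.univ a : ℝ) * ∏ b : Fin z, xi p q (a b)

/-- The probability `p_i(k, η)` that a vertex of type `i` and mass `m` has `k` children and
mark `η`. -/
noncomputable def typedLaw (p : PMF ℕ) (q : ℕ → unitInterval) (i : ℕ) (m : ℝ) (k : ℕ) (η : Bool) :
    ℝ :=
  if i = 0 then (reproMarkLaw p q (k, η)).toReal
  else (reproMarkLaw p q (k, η)).toReal * weight p q i (m + η.toNat) k / weight p q i m 1

/-- The probability `γ` that the vertices of generation `n` of `t` receive the types `s`. -/
noncomputable def typeProb (p : PMF ℕ) (q : ℕ → unitInterval) (ℓ : ℕ) (t : MarkedTree) (n : ℕ)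
    (s : List ℕ → ℕ) : ℝ :=
  (ℓ ! : ℝ) / (∏ u ∈ t.level n, ((s u)! : ℝ)) *
    ((∏ u ∈ t.level n, weight p q (s u) (t.mass u) 1 * xi p q (s u)) /
      (xi p q ℓ * weight p q ℓ (t.numMarks n) (t.levelSize n)))

/-- `Q` has density `f_ℓ(M_n, Z_n)` on `ℱ_n`, for every `n`, with respect to the law of the marked
Galton-Watson tree. -/
def IsGirsanovTransform (p : PMF ℕ) (q : ℕ → unitInterval) (ℓ : ℕ) (Q : Measure MarkedTree) :
    Prop :=
  ∀ (n : ℕ) (A : Set MarkedTree), MeasurableSet[MarkedTree.filtration n] A →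
    Q A = ∫⁻ t in A, ENNReal.ofReal (weight p q ℓ (t.numMarks n) (t.levelSize n))
      ∂(markedGaltonWatson p q)

/-- The random marked tree `τ`, with the type `T · u` of each vertex `u`, is a weighted tree of
type `ℓ`. In `reproduction` and `types` the conditional probability of a generation given the past
is written as a product formula: given the tree up to generation `n` and its types, the vertices of
generation `n` reproduce and are marked independently with their laws `p_i`; given moreover
generation `n + 1`, if it is not empty, its types are drawn with the probabilities `γ`. -/
structure IsWeightedTree (p : PMF ℕ) (q : ℕ → unitInterval) (ℓ : ℕ) {Ω : Type*}
    [MeasurableSpace Ω] (P : Measure Ω) (τ : Ω → MarkedTree) (T : Ω → List ℕ → ℕ) : Prop where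
  measurable_tree : Measurable τ
  measurable_type : ∀ u : List ℕ, Measurable fun ω => T ω u
  root_type : ∀ᵐ ω ∂P, T ω [] = ℓ
  sum_type : ∀ n : ℕ, ∀ᵐ ω ∂P, ((τ ω).level n).Nonempty → ∑ u ∈ (τ ω).level n, T ω u = ℓ
  reproduction : ∀ (n : ℕ) (t : MarkedTree) (s : List ℕ → ℕ),
    P {ω | (τ ω).restrict (n + 1) = t.restrict (n + 1) ∧
        ∀ u ∈ t.nodes, u.length ≤ n → T ω u = s u} =
      P {ω | (τ ω).restrict n = t.restrict n ∧ ∀ u ∈ t.nodes, u.length ≤ n → T ω u = s u} *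
        ∏ u ∈ t.level n,
          ENNReal.ofReal (typedLaw p q (s u) (t.mass u) (t.numChildren u) (t.mark u))
  types : ∀ (n : ℕ) (t : MarkedTree) (s : List ℕ → ℕ), (t.level (n + 1)).Nonempty →
    ∑ u ∈ t.level (n + 1), s u = ℓ →
    P {ω | (τ ω).restrict (n + 1) = t.restrict (n + 1) ∧
        ∀ u ∈ t.nodes, u.length ≤ n + 1 → T ω u = s u} =
      P {ω | (τ ω).restrict (n + 1) = t.restrict (n + 1) ∧
        ∀ u ∈ t.nodes, u.length ≤ n → T ω u = s u} *
        ENNReal.ofReal (typeProb p q ℓ t (n + 1) s)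

/-! Let `G(s, z) = e^{sX} (∑ ξ_j X^j / j!)^z` (`momentSeries`) be the exponential generating series
of the moments of `s` plus `z` independent copies of `M_∞`, and let `c_i(s, z)` be its coefficients.
Then `ξ_i f_i(s, z) = i! c_i(s, z)`, and everything rests on `G(s, z) G(s', z') = G(s + s', z +
z')`.

For types at most `ℓ` the factorials and moments cancel: `p_i(k, η) = p_0(k, η) c_i(m + η, k) /
c_i(m, 1)`, and the type probability of generation `n` is `∏ c_{t_u}(m_u, 1) / c_ℓ(M_n, Z_n)`. When
`f_ℓ(M_n, Z_n)`, this probability and the laws `p_{t_u}` of generation `n` are multiplied, the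
factors `c_{t_u}(m_u, 1)` and `c_ℓ(M_n, Z_n)` disappear. What remains is `(ℓ! / ξ_ℓ) ∏ p_0(k_u, η_u)
c_{t_u}(m_u + η_u, k_u)`. Summing over types of total `ℓ` extracts a coefficient of a product of
series. Since the masses of a nonempty generation add up to `M_n`, that coefficient is `c_ℓ(M_{n+1},
Z_{n+1})`. This is `sum_typeProb_mul_typedLaw`. By induction a weighted tree gives every cylinder
its Galton–Watson probability times `f_ℓ(M_n, Z_n)` (`IsWeightedTree.measure_cylinder`), and
cylinders determine the measure (`isGirsanovTransform_iff`, `IsGirsanovTransform.eq`).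

It remains that weighted trees exist. The type probabilities sum to `1` by the same convolution, and
the `p_i` by the moment form of the branching equation `M_∞ = η_∅ + (sum of k_∅ independent copies)`
(`markMoment_add_one`). Both need `0 < ξ_i < ∞` for `i ≤ ℓ`; finiteness comes from subcriticality
(`markMoment_top_lt_top`). The tree is then read off from independent draws made in advance for
every vertex, type and past (`WeightedTreeSpace.isWeightedTree`). Its law supplies `Q_ℓ`, so no
separate extension argument is needed. -/

namespace MarkedTree

/-! ### Restrictions, generations and masses of marked trees -/

theorem mem_level {t : MarkedTree} {n : ℕ} {u : List ℕ} :
    u ∈ t.level n ↔ u ∈ t.nodes ∧ u.length = n := by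
  simp [level]

theorem append_mem_iff {t : MarkedTree} {u : List ℕ} (hu : u ∈ t.nodes) (i : ℕ) :
    u ++ [i] ∈ t.nodes ↔ i < t.numChildren u := by
  obtain ⟨k, hk⟩ := t.children u hu
  have : {i : ℕ | u ++ [i] ∈ t.nodes} = Set.Iio k := by ext i; simp [hk]
  rw [numChildren, this, hk, Set.ncard_eq_toFinset_card']
  simp

theorem numChildren_eq_iff {t : MarkedTree} {u : List ℕ} (hu : u ∈ t.nodes) (k : ℕ) :
    t.numChildren u = k ↔ ∀ i, u ++ [i] ∈ t.nodes ↔ i < k := by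
  refine ⟨fun h i => h ▸ append_mem_iff hu i, fun h => ?_⟩
  simp only [append_mem_iff hu] at h
  have h1 := h k
  have h2 := h (t.numChildren u)
  omega

theorem restrict_eq_iff {t t' : MarkedTree} {n : ℕ} :
    t.restrict n = t'.restrict n ↔
      (∀ u : List ℕ, u.length ≤ n → (u ∈ t.nodes ↔ u ∈ t'.nodes)) ∧
        ∀ u : List ℕ, u.length < n → t.mark u = t'.mark u := by
  rw [MarkedTree.ext_iff]
  refine and_congr ?_ ?_
  · simp only [restrict, Set.ext_iff, Set.mem_ofPred_eq]
    exact forall_congr' fun u => by tauto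
  · simp only [restrict, funext_iff]
    refine forall_congr' fun u => ?_
    by_cases h : u.length < n <;> simp [h]

theorem restrict_zero_eq (t t' : MarkedTree) : t.restrict 0 = t'.restrict 0 := by
  rw [restrict_eq_iff]
  refine ⟨fun u hu => ?_, fun u hu => by simp at hu⟩
  obtain rfl : u = [] := by simpa using hu
  simp [t.nil_mem, t'.nil_mem]

theorem restrict_eq_of_le {t t' : MarkedTree} {m n : ℕ} (hmn : m ≤ n)
    (h : t.restrict n = t'.restrict n) : t.restrict m = t'.restrict m := by
  rw [restrict_eq_iff] at h ⊢
  exact ⟨fun u hu => h.1 u (hu.trans hmn), fun u hu => h.2 u (hu.trans_le hmn)⟩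

theorem restrict_restrict (t : MarkedTree) (n : ℕ) :
    (t.restrict n).restrict n = t.restrict n := by
  rw [restrict_eq_iff]
  constructor
  · intro u hu
    simp [restrict, hu]
  · intro u hu
    simp [restrict, hu]

theorem mem_of_restrict_eq {t t' : MarkedTree} {n : ℕ} (h : t.restrict n = t'.restrict n)
    {u : List ℕ} (hu : u.length ≤ n) : u ∈ t.nodes ↔ u ∈ t'.nodes :=
  (restrict_eq_iff.mp h).1 u hu

theorem mark_of_restrict_eq {t t' : MarkedTree} {n : ℕ} (h : t.restrict n = t'.restrict n)
    {u : List ℕ} (hu : u.length < n) : t.mark u = t'.mark u :=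
  (restrict_eq_iff.mp h).2 u hu

theorem numChildren_of_restrict_eq {t t' : MarkedTree} {n : ℕ}
    (h : t.restrict n = t'.restrict n) {u : List ℕ} (hu : u.length < n) :
    t.numChildren u = t'.numChildren u := by
  simp only [numChildren]
  congr 1
  ext i
  exact mem_of_restrict_eq h (by simpa using hu)

theorem level_of_restrict_eq {t t' : MarkedTree} {m n : ℕ} (hm : m ≤ n)
    (h : t.restrict n = t'.restrict n) : t.level m = t'.level m := by
  ext u
  simp only [mem_level]
  refine and_congr_left fun hu => mem_of_restrict_eq h (by omega)

/-- One more generation of information is exactly the offspring numbers and marks of generation `n`.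
This is what turns cylinder probabilities into products over generations. Words of length `n`
outside the tree carry nothing, because children and marks force membership. -/
theorem restrict_succ_eq_iff {t t' : MarkedTree} {n : ℕ} :
    t.restrict (n + 1) = t'.restrict (n + 1) ↔ t.restrict n = t'.restrict n ∧
      ∀ u ∈ t'.level n, t.numChildren u = t'.numChildren u ∧ t.mark u = t'.mark u := by
  constructor
  · intro h
    refine ⟨restrict_eq_of_le n.le_succ h, fun u hu => ?_⟩
    have hl : u.length < n + 1 := by rw [(mem_level.mp hu).2]; omega
    exact ⟨numChildren_of_restrict_eq h hl, mark_of_restrict_eq h hl⟩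
  · rintro ⟨h, h'⟩
    rw [restrict_eq_iff]
    constructor
    · intro v hv
      rcases Nat.lt_or_ge n v.length with hn | hn
      · rcases List.eq_nil_or_concat' v with rfl | ⟨u, i, rfl⟩
        · simp at hn
        · have hl : u.length = n := by simp at hv hn; omega
          have hmem := mem_of_restrict_eq h hl.le
          by_cases hu : u ∈ t'.nodes
          · rw [append_mem_iff hu, append_mem_iff (hmem.mpr hu),
              (h' u (mem_level.mpr ⟨hu, hl⟩)).1]
          · exact iff_of_false (fun hc => hu (hmem.mp (t.parent_mem _ _ hc)))
              fun hc => hu (t'.parent_mem _ _ hc)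
      · exact mem_of_restrict_eq h hn
    · intro u hu
      rcases Nat.lt_or_ge u.length n with hn | hn
      · exact mark_of_restrict_eq h hn
      · have hl : u.length = n := by omega
        have hmem := mem_of_restrict_eq h hl.le
        by_cases hut : u ∈ t'.nodes
        · exact (h' u (mem_level.mpr ⟨hut, hl⟩)).2
        · have h1 : t.mark u ≠ true := fun hc => hut (hmem.mp (t.mem_of_mark u hc))
          have h2 : t'.mark u ≠ true := fun hc => hut (t'.mem_of_mark u hc)
          simp_all

/-- The mass recursion for generation `m` uses marks and offspring numbers of earlier generations
and the size of generation `m`, all visible in the restriction. -/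
theorem massAt_of_restrict_eq {t t' : MarkedTree} {m n : ℕ} (hm : m ≤ n)
    (h : t.restrict n = t'.restrict n) {u : List ℕ} (hu : u.length = m) :
    t.massAt m u = t'.massAt m u := by
  induction m generalizing u with
  | zero => rfl
  | succ m ih =>
    have key : ∀ w : List ℕ, w.length = m → t.massAt m w + t.eta w = t'.massAt m w + t'.eta w ∧
        t.numChildren w = t'.numChildren w := by
      intro w hw
      refine ⟨?_, numChildren_of_restrict_eq h (by omega)⟩
      rw [ih (by omega) hw, eta, eta, mark_of_restrict_eq h (by omega)]
    have hd : u.dropLast.length = m := by simp [hu]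
    simp only [massAt]
    rw [(key _ hd).1, (key _ hd).2, levelSize, levelSize, level_of_restrict_eq hm h,
      level_of_restrict_eq (Nat.le_of_succ_le hm) h]
    congr 2
    refine Finset.sum_congr (Finset.filter_congr fun w hw => ?_) fun w hw => ?_
    · rw [(key w (mem_level.mp hw).2).2]
    · exact (key w (mem_level.mp (Finset.mem_filter.mp hw).1).2).1

theorem mass_of_restrict_eq {t t' : MarkedTree} {n : ℕ} (h : t.restrict n = t'.restrict n)
    {u : List ℕ} (hu : u.length ≤ n) : t.mass u = t'.mass u :=
  massAt_of_restrict_eq hu h rfl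

theorem numMarks_of_restrict_eq {t t' : MarkedTree} {n : ℕ} (h : t.restrict n = t'.restrict n) :
    t.numMarks n = t'.numMarks n := by
  refine Finset.sum_congr rfl fun i hi => ?_
  have hi := Finset.mem_range.mp hi
  rw [level_of_restrict_eq hi.le h]
  refine Finset.sum_congr rfl fun u hu => ?_
  rw [eta, eta, mark_of_restrict_eq h (by rw [(mem_level.mp hu).2]; exact hi)]

/-- The vertices of generations `0, …, n - 1`. -/
noncomputable def past (t : MarkedTree) (n : ℕ) : Finset (List ℕ) :=
  (Finset.range n).biUnion t.level

theorem mem_past {t : MarkedTree} {n : ℕ} {u : List ℕ} :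
    u ∈ t.past n ↔ u ∈ t.nodes ∧ u.length < n := by
  simp [past, mem_level, and_comm]

theorem past_zero (t : MarkedTree) : t.past 0 = ∅ := by simp [past]

theorem disjoint_past_level (t : MarkedTree) (n : ℕ) : Disjoint (t.past n) (t.level n) := by
  rw [Finset.disjoint_left]
  intro u hu hu'
  have := (mem_past.mp hu).2
  have := (mem_level.mp hu').2
  omega

theorem past_succ (t : MarkedTree) (n : ℕ) : t.past (n + 1) = t.past n ∪ t.level n := by
  ext u
  simp only [Finset.mem_union, mem_past, mem_level, ← and_or_left]
  refine and_congr_right fun _ => by omega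

theorem sum_level_succ {α : Type*} [AddCommMonoid α] (t : MarkedTree) (n : ℕ)
    (f : List ℕ → α) :
    ∑ v ∈ t.level (n + 1), f v =
      ∑ u ∈ t.level n, ∑ i ∈ Finset.range (t.numChildren u), f (u ++ [i]) := by
  rw [Finset.sum_sigma']
  symm
  refine Finset.sum_bij (fun x _ => x.1 ++ [x.2]) ?_ ?_ ?_ ?_
  · rintro ⟨u, i⟩ h
    simp only [Finset.mem_sigma, mem_level, Finset.mem_range] at h ⊢
    exact ⟨(append_mem_iff h.1.1 i).mpr h.2, by simp [h.1.2]⟩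
  · rintro ⟨u, i⟩ _ ⟨v, j⟩ _ h
    obtain ⟨rfl, h'⟩ := List.append_inj' h rfl
    obtain rfl : i = j := by simpa using h'
    rfl
  · intro v hv
    obtain ⟨hv, hl⟩ := mem_level.mp hv
    rcases List.eq_nil_or_concat' v with rfl | ⟨u, i, rfl⟩
    · simp at hl
    · have hu := t.parent_mem u i hv
      refine ⟨⟨u, i⟩, ?_, rfl⟩
      simp only [Finset.mem_sigma, mem_level, Finset.mem_range]
      exact ⟨⟨hu, by simpa using hl⟩, (append_mem_iff hu i).mp hv⟩
  · intros; rfl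

theorem levelSize_succ (t : MarkedTree) (n : ℕ) :
    t.levelSize (n + 1) = ∑ u ∈ t.level n, t.numChildren u := by
  rw [levelSize, Finset.card_eq_sum_ones, sum_level_succ]
  simp

theorem numMarks_succ (t : MarkedTree) (n : ℕ) :
    t.numMarks (n + 1) = t.numMarks n + ∑ u ∈ t.level n, t.eta u := by
  rw [numMarks, Finset.sum_range_succ, numMarks]

theorem level_zero (t : MarkedTree) : t.level 0 = {[]} := by
  ext u
  rw [mem_level, List.length_eq_zero_iff, Finset.mem_singleton]
  exact ⟨fun h => h.2, fun h => ⟨h ▸ t.nil_mem, h⟩⟩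

theorem level_succ_eq_empty {t : MarkedTree} {n : ℕ} (h : t.level n = ∅) :
    t.level (n + 1) = ∅ := by
  have := levelSize_succ t n
  rw [h, Finset.sum_empty, levelSize] at this
  exact Finset.card_eq_zero.mp this

theorem massAt_nonneg (t : MarkedTree) (n : ℕ) (u : List ℕ) : 0 ≤ t.massAt n u := by
  induction n generalizing u with
  | zero => exact le_rfl
  | succ n ih =>
    have h : ∀ w, 0 ≤ t.massAt n w + t.eta w := fun w => add_nonneg (ih w) (Nat.cast_nonneg _)
    exact add_nonneg (div_nonneg (h _) (Nat.cast_nonneg _))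
      (div_nonneg (Finset.sum_nonneg fun w _ => h w) (Nat.cast_nonneg _))

theorem mass_nonneg (t : MarkedTree) (u : List ℕ) : 0 ≤ t.mass u := t.massAt_nonneg _ u

/-- Conservation of mass: each vertex hands on all of `m_u + η_u`, to its children or, if childless,
to the whole next generation. Nonemptiness is needed because the share of the childless vertices is
divided by `Z_{n+1}`. -/
theorem sum_massAt_level (t : MarkedTree) (n : ℕ) (hn : (t.level n).Nonempty) :
    ∑ u ∈ t.level n, t.massAt n u = t.numMarks n := by
  induction n with
  | zero => simp [massAt, numMarks]
  | succ n ih =>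
    have hne : (t.level n).Nonempty := by
      by_contra h
      rw [level_succ_eq_empty (Finset.not_nonempty_iff_eq_empty.mp h)] at hn
      exact Finset.not_nonempty_empty hn
    have hZ : (t.levelSize (n + 1) : ℝ) ≠ 0 :=
      Nat.cast_ne_zero.mpr (Finset.card_pos.mpr hn).ne'
    simp only [massAt]
    rw [Finset.sum_add_distrib, Finset.sum_const, nsmul_eq_mul]
    change _ + (t.levelSize (n + 1) : ℝ) * _ = _
    rw [mul_div_cancel₀ _ hZ, sum_level_succ, numMarks_succ, Nat.cast_add, ← ih hne,
      Nat.cast_sum, ← Finset.sum_add_distrib, Finset.sum_filter, ← Finset.sum_add_distrib]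
    refine Finset.sum_congr rfl fun u _ => ?_
    by_cases hk : t.numChildren u = 0
    · simp [hk]
    · simp [hk, mul_div_cancel₀ _ (Nat.cast_ne_zero (R := ℝ).mpr hk)]

theorem sum_mass_level (t : MarkedTree) (n : ℕ) (hn : (t.level n).Nonempty) :
    ∑ u ∈ t.level n, t.mass u = t.numMarks n := by
  rw [← sum_massAt_level t n hn]
  refine Finset.sum_congr rfl fun u hu => ?_
  rw [mass, (mem_level.mp hu).2]

/-- A restricted tree is coded by two finite sets of words, its vertices and its marked vertices.
The space of trees itself is uncountable, and this countability is what replaces discreteness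
throughout. -/
theorem countable_range_restrict (n : ℕ) : (Set.range (restrict n)).Countable := by
  let c : MarkedTree → Finset (List ℕ) × Finset (List ℕ) := fun t =>
    (t.past (n + 1), (t.past (n + 1)).filter fun u => t.mark u = true)
  have hc : Set.InjOn c (Set.range (restrict n)) := by
    rintro _ ⟨t, rfl⟩ _ ⟨t', rfl⟩ h
    obtain ⟨h1, h2⟩ := Prod.ext_iff.mp h
    simp only [c, Finset.ext_iff, mem_past, Finset.mem_filter] at h1 h2
    rw [← restrict_restrict t, ← restrict_restrict t', restrict_eq_iff]
    have hm : ∀ u : List ℕ, u.length ≤ n →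
        (u ∈ (restrict n t).nodes ↔ u ∈ (restrict n t').nodes) := fun u hu => by
      have := h1 u
      simp only [Nat.lt_succ_of_le hu, and_true] at this
      exact this
    refine ⟨hm, fun u hu => Bool.eq_iff_iff.mpr ?_⟩
    have h3 := h2 u
    have h4 := (restrict n t).mem_of_mark u
    have h5 := (restrict n t').mem_of_mark u
    have h6 : u.length < n + 1 := by omega
    tauto
  exact Set.MapsTo.countable_of_injOn (Set.mapsTo_univ c _) hc Set.countable_univ

/-! ### Measurability on the space of marked trees -/

theorem measurableSet_mem (u : List ℕ) : MeasurableSet {t : MarkedTree | u ∈ t.nodes} :=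
  MeasurableSpace.measurableSet_generateFrom (Or.inl ⟨u, rfl⟩)

theorem measurableSet_mark (u : List ℕ) : MeasurableSet {t : MarkedTree | t.mark u = true} :=
  MeasurableSpace.measurableSet_generateFrom (Or.inr ⟨u, rfl⟩)

theorem measurable_iff {Ω : Type*} [MeasurableSpace Ω] {f : Ω → MarkedTree} :
    Measurable f ↔ (∀ u, MeasurableSet {ω | u ∈ (f ω).nodes}) ∧
      ∀ u, MeasurableSet {ω | (f ω).mark u = true} := by
  refine ⟨fun h => ⟨fun u => h (measurableSet_mem u), fun u => h (measurableSet_mark u)⟩,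
    fun h => measurable_generateFrom ?_⟩
  rintro _ (⟨u, rfl⟩ | ⟨u, rfl⟩)
  · exact h.1 u
  · exact h.2 u

theorem measurable_restrict (n : ℕ) : Measurable (restrict n) := by
  rw [measurable_iff]
  constructor
  · intro u
    exact (measurableSet_mem u).inter (MeasurableSet.const (u.length ≤ n))
  · intro u
    have : {t : MarkedTree | (restrict n t).mark u = true} =
        {t | t.mark u = true} ∩ {_t | u.length < n} := by
      ext t; simp [restrict]
    rw [this]
    exact (measurableSet_mark u).inter (MeasurableSet.const _)

instance : MeasurableSingletonClass MarkedTree := by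
  refine ⟨fun t => ?_⟩
  have : {t} = ⋂ u : List ℕ, {t' : MarkedTree | u ∈ t'.nodes ↔ u ∈ t.nodes} ∩
      {t' | t'.mark u = true ↔ t.mark u = true} := by
    ext t'
    simp only [Set.mem_singleton_iff, Set.mem_iInter, Set.mem_inter_iff, Set.mem_ofPred_eq,
      MarkedTree.ext_iff, Set.ext_iff, funext_iff, ← Bool.eq_iff_iff, forall_and]
  rw [this]
  refine MeasurableSet.iInter fun u => MeasurableSet.inter ?_ ?_
  · exact (measurableSet_mem u).iff (MeasurableSet.const _)
  · exact (measurableSet_mark u).iff (MeasurableSet.const _)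

theorem numChildren_ofFamily {x : List ℕ → ℕ × Bool} {u : List ℕ}
    (hu : u ∈ (ofFamily x).nodes) : (ofFamily x).numChildren u = (x u).1 := by
  rw [numChildren_eq_iff hu]
  refine fun i => ⟨fun h => h u i (List.prefix_refl _), fun hi v j hv => ?_⟩
  rcases List.prefix_concat_iff.mp hv with h | h
  · obtain ⟨rfl, h'⟩ := List.append_inj' h rfl
    obtain rfl : j = i := by simpa using h'
    exact hi
  · exact hu v j h

theorem mark_ofFamily_eq_true_iff {x : List ℕ → ℕ × Bool} {u : List ℕ} :
    (ofFamily x).mark u = true ↔ (x u).2 = true ∧ u ∈ (ofFamily x).nodes := by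
  simp [ofFamily]

theorem mark_ofFamily {x : List ℕ → ℕ × Bool} {u : List ℕ}
    (hu : u ∈ (ofFamily x).nodes) : (ofFamily x).mark u = (x u).2 := by
  rw [Bool.eq_iff_iff, mark_ofFamily_eq_true_iff]
  simp [hu]

theorem cons_mem_ofFamily {x : List ℕ → ℕ × Bool} {b : ℕ} {u : List ℕ} :
    b :: u ∈ (ofFamily x).nodes ↔
      b < (x []).1 ∧ u ∈ (ofFamily fun v => x (b :: v)).nodes := by
  constructor
  · intro h
    refine ⟨h [] b (by simp), fun v i hv => h (b :: v) i ?_⟩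
    simpa using hv
  · rintro ⟨hb, h⟩ v i hv
    rcases v with _ | ⟨c, v⟩
    · obtain rfl : i = b := by simpa using hv
      exact hb
    · rw [List.cons_append, List.cons_prefix_cons] at hv
      obtain ⟨rfl, hv⟩ := hv
      exact h v i hv

theorem measurable_ofFamily : Measurable ofFamily := by
  have hx : ∀ u : List ℕ, Measurable fun x : List ℕ → ℕ × Bool => x u := measurable_pi_apply
  have hn : ∀ u, MeasurableSet {x : List ℕ → ℕ × Bool | u ∈ (ofFamily x).nodes} := by
    intro u
    have : {x : List ℕ → ℕ × Bool | u ∈ (ofFamily x).nodes} =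
        ⋂ (v : List ℕ) (i : ℕ) (_ : v ++ [i] <+: u), {x | i < (x v).1} := by
      ext x
      simp [ofFamily]
    rw [this]
    refine MeasurableSet.iInter fun v => MeasurableSet.iInter fun i =>
      MeasurableSet.iInter fun _ => ?_
    exact measurableSet_lt measurable_const (hx v).fst
  refine measurable_iff.mpr ⟨hn, fun u => ?_⟩
  simp only [mark_ofFamily_eq_true_iff]
  exact MeasurableSet.inter ((hx u).snd (measurableSet_singleton true)) (hn u)

end MarkedTree

/-! ### Generating series of moments and the functions `f_i` -/

/-- The series `e^{s X} (∑ j, x_j X^j / j!)^z`. When `x_j` are the moments of a random variable,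
its coefficients are the moments, divided by factorials, of `s` plus the sum of `z` independent
copies. -/
noncomputable def momentSeries (x : ℕ → ℝ) (s : ℝ) (z : ℕ) : PowerSeries ℝ :=
  PowerSeries.rescale s (PowerSeries.exp ℝ) * (PowerSeries.mk fun j => x j / (j ! : ℝ)) ^ z

theorem momentSeries_mul (x : ℕ → ℝ) (s s' : ℝ) (z z' : ℕ) :
    momentSeries x s z * momentSeries x s' z' = momentSeries x (s + s') (z + z') := by
  rw [momentSeries, momentSeries, momentSeries, ← PowerSeries.exp_mul_exp_eq_exp_add, pow_add]
  ring

theorem momentSeries_zero_zero (x : ℕ → ℝ) : momentSeries x 0 0 = 1 := by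
  ext n
  rcases n with _ | n <;> simp [momentSeries, PowerSeries.coeff_one]

theorem momentSeries_prod {ι : Type*} (x : ℕ → ℝ) (F : Finset ι) (s : ι → ℝ) (z : ι → ℕ) :
    ∏ u ∈ F, momentSeries x (s u) (z u) = momentSeries x (∑ u ∈ F, s u) (∑ u ∈ F, z u) := by
  classical
  induction F using Finset.induction_on with
  | empty => simp [momentSeries_zero_zero]
  | insert a F ha ih => rw [Finset.prod_insert ha, ih, momentSeries_mul, Finset.sum_insert ha,
      Finset.sum_insert ha]

theorem PowerSeries.coeff_prod_piAntidiag {ι : Type*} [DecidableEq ι] {R : Type*} [CommSemiring R]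
    (f : ι → PowerSeries R) (d : ℕ) (s : Finset ι) :
    PowerSeries.coeff d (∏ j ∈ s, f j) =
      ∑ l ∈ s.piAntidiag d, ∏ i ∈ s, PowerSeries.coeff (l i) (f i) := by
  rw [PowerSeries.coeff_prod]
  refine Finset.sum_bij (fun l _ => l) ?_ ?_ ?_ ?_
  · intro l hl
    rw [Finset.mem_finsuppAntidiag] at hl
    rw [Finset.mem_piAntidiag]
    exact ⟨hl.1, fun i hi => hl.2 (Finsupp.mem_support_iff.mpr hi)⟩
  · intro l _ l' _ h
    exact DFunLike.coe_injective h
  · intro l hl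
    rw [Finset.mem_piAntidiag] at hl
    refine ⟨Finsupp.onFinset s l hl.2, ?_, rfl⟩
    rw [Finset.mem_finsuppAntidiag]
    exact ⟨hl.1, Finsupp.support_onFinset_subset⟩
  · intros; rfl

theorem coeff_momentSeries_prod {ι : Type*} [DecidableEq ι] (x : ℕ → ℝ) (F : Finset ι)
    (s : ι → ℝ) (z : ι → ℕ) (d : ℕ) :
    ∑ l ∈ F.piAntidiag d, ∏ u ∈ F, PowerSeries.coeff (l u) (momentSeries x (s u) (z u)) =
      PowerSeries.coeff d (momentSeries x (∑ u ∈ F, s u) (∑ u ∈ F, z u)) := by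
  rw [← momentSeries_prod, PowerSeries.coeff_prod_piAntidiag]

/-- Dividing by factorials turns the multinomial convolution of moments into an ordinary product of
series. -/
theorem factorial_mul_coeff_pow (x : ℕ → ℝ) (z j : ℕ) :
    (j ! : ℝ) * PowerSeries.coeff j ((PowerSeries.mk fun j => x j / (j ! : ℝ)) ^ z) =
      ∑ a ∈ Finset.piAntidiag (Finset.univ : Finset (Fin z)) j,
        (Nat.multinomial Finset.univ a : ℝ) * ∏ b : Fin z, x (a b) := by
  have h : (PowerSeries.mk fun j => x j / (j ! : ℝ)) ^ z =
      ∏ _b : Fin z, (PowerSeries.mk fun j => x j / (j ! : ℝ)) := by simp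
  rw [h, PowerSeries.coeff_prod_piAntidiag, Finset.mul_sum]
  refine Finset.sum_congr rfl fun a ha => ?_
  have hs := (Finset.mem_piAntidiag.mp ha).1
  have hm := Nat.multinomial_spec (Finset.univ : Finset (Fin z)) a
  rw [show ∑ i, a i = j from hs] at hm
  have hm' : (j ! : ℝ) = (∏ b : Fin z, ((a b)! : ℝ)) * (Nat.multinomial Finset.univ a : ℝ) := by
    rw [← hm]; push_cast; rfl
  have hne : (∏ b : Fin z, ((a b)! : ℝ)) ≠ 0 :=
    Finset.prod_ne_zero_iff.mpr fun b _ => Nat.cast_ne_zero.mpr (Nat.factorial_ne_zero _)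
  simp only [PowerSeries.coeff_mk, Finset.prod_div_distrib]
  rw [hm']
  field_simp

theorem factorial_mul_coeff_momentSeries (x : ℕ → ℝ) (i : ℕ) (s : ℝ) (z : ℕ) :
    (i ! : ℝ) * PowerSeries.coeff i (momentSeries x s z) =
      ∑ j ∈ Finset.range (i + 1), (i.choose j : ℝ) * s ^ (i - j) *
        ∑ a ∈ Finset.piAntidiag (Finset.univ : Finset (Fin z)) j,
          (Nat.multinomial Finset.univ a : ℝ) * ∏ b : Fin z, x (a b) := by
  rw [momentSeries, mul_comm (PowerSeries.rescale _ _), PowerSeries.coeff_mul,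
    Finset.Nat.sum_antidiagonal_eq_sum_range_succ_mk, Finset.mul_sum]
  refine Finset.sum_congr rfl fun j hj => ?_
  have hj : j ≤ i := Nat.lt_succ_iff.mp (Finset.mem_range.mp hj)
  rw [← factorial_mul_coeff_pow, PowerSeries.coeff_rescale, PowerSeries.coeff_exp,
    ← Nat.choose_mul_factorial_mul_factorial hj]
  have := Nat.cast_ne_zero (R := ℝ).mpr (Nat.factorial_ne_zero (i - j))
  simp only [one_div, map_inv₀, map_natCast]
  push_cast
  field_simp

theorem coeff_momentSeries_nonneg {x : ℕ → ℝ} (hx : ∀ j, 0 ≤ x j) (i : ℕ) {s : ℝ} (hs : 0 ≤ s)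
    (z : ℕ) : 0 ≤ PowerSeries.coeff i (momentSeries x s z) := by
  refine nonneg_of_mul_nonneg_right (a := (i ! : ℝ)) ?_ (Nat.cast_pos.mpr i.factorial_pos)
  rw [factorial_mul_coeff_momentSeries]
  exact Finset.sum_nonneg fun j _ => mul_nonneg (by positivity) (Finset.sum_nonneg fun a _ =>
    mul_nonneg (Nat.cast_nonneg _) (Finset.prod_nonneg fun b _ => hx _))

/-- With at least one copy present, that single copy can carry the whole order `i`. For `z = 0` and
`s = 0` the coefficient may vanish. -/
theorem coeff_momentSeries_pos {x : ℕ → ℝ} (hx : ∀ j, 0 ≤ x j) (h0 : 0 < x 0) {i : ℕ}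
    (hi : 0 < x i) {s : ℝ} (hs : 0 ≤ s) {z : ℕ} (hz : z ≠ 0) :
    0 < PowerSeries.coeff i (momentSeries x s z) := by
  obtain ⟨y, rfl⟩ := Nat.exists_eq_succ_of_ne_zero hz
  have h1 : momentSeries x s (y + 1) = momentSeries x s y * momentSeries x 0 1 := by
    rw [momentSeries_mul, add_zero]
  have h2 : momentSeries x 0 1 = PowerSeries.mk fun j => x j / (j ! : ℝ) := by
    have : PowerSeries.rescale (0 : ℝ) (PowerSeries.exp ℝ) = 1 := by
      simp
    rw [momentSeries, this, pow_one, one_mul]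
  rw [Nat.succ_eq_add_one, h1, PowerSeries.coeff_mul]
  -- One term of the Cauchy product suffices: order `0` for the other factors, where the coefficient
  -- is a power of `x 0`, and order `i` for the separated copy.
  have hmem : ((0, i) : ℕ × ℕ) ∈ Finset.HasAntidiagonal.antidiagonal i := by simp
  refine (?_ : (0 : ℝ) < _).trans_le (Finset.single_le_sum (fun a _ =>
    mul_nonneg (coeff_momentSeries_nonneg hx a.1 hs y)
      (coeff_momentSeries_nonneg hx a.2 le_rfl 1)) hmem)
  refine mul_pos ?_ ?_
  · have h3 := factorial_mul_coeff_momentSeries x 0 s y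
    simp [Nat.multinomial] at h3
    dsimp only
    rw [PowerSeries.coeff_zero_eq_constantCoeff, h3]
    positivity
  · rw [h2, PowerSeries.coeff_mk]
    exact div_pos hi (Nat.cast_pos.mpr i.factorial_pos)

theorem coeff_momentSeries_zero_one (x : ℕ → ℝ) (i : ℕ) :
    PowerSeries.coeff i (momentSeries x 0 1) = x i / (i ! : ℝ) := by
  have : PowerSeries.rescale (0 : ℝ) (PowerSeries.exp ℝ) = 1 := by
    simp
  rw [momentSeries, this, pow_one, one_mul, PowerSeries.coeff_mk]

section Weight

variable (p : PMF ℕ) (q : ℕ → unitInterval)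

theorem xi_nonneg (i : ℕ) : 0 ≤ xi p q i := ENNReal.toReal_nonneg

theorem weight_eq (i : ℕ) (s : ℝ) (z : ℕ) :
    weight p q i s z =
      (i ! : ℝ) * PowerSeries.coeff i (momentSeries (xi p q) s z) / xi p q i := by
  rw [weight, factorial_mul_coeff_momentSeries, one_div, inv_mul_eq_div]

theorem weight_nonneg (i : ℕ) {s : ℝ} (hs : 0 ≤ s) (z : ℕ) : 0 ≤ weight p q i s z := by
  rw [weight_eq]
  exact div_nonneg (mul_nonneg (Nat.cast_nonneg _)
    (coeff_momentSeries_nonneg (xi_nonneg p q) i hs z)) (xi_nonneg p q i)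

variable {p q}

theorem weight_mul_xi {i : ℕ} (hi : xi p q i ≠ 0) (s : ℝ) (z : ℕ) :
    weight p q i s z * xi p q i =
      (i ! : ℝ) * PowerSeries.coeff i (momentSeries (xi p q) s z) := by
  rw [weight_eq, div_mul_cancel₀ _ hi]

theorem weight_zero_left (h0 : xi p q 0 = 1) (s : ℝ) (z : ℕ) : weight p q 0 s z = 1 := by
  simp [weight, h0, Nat.multinomial]

theorem weight_zero_one {i : ℕ} (hi : xi p q i ≠ 0) : weight p q i 0 1 = 1 := by
  rw [weight_eq, coeff_momentSeries_zero_one, mul_div_cancel₀, div_self hi]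
  exact Nat.cast_ne_zero.mpr i.factorial_ne_zero

end Weight

/-! ### Decomposition at the root: the branching property -/

theorem ENNReal.tsum_list {α : Type*} (f : List α → ℝ≥0∞) :
    ∑' u, f u = f [] + ∑' b, ∑' u, f (b :: u) := by
  have h1 : ({[]} : Set (List α))ᶜ = Set.range fun x : α × List α => x.1 :: x.2 := by
    ext u
    rcases u with _ | ⟨b, u⟩ <;> simp
  have hinj : Function.Injective fun x : α × List α => x.1 :: x.2 := by
    rintro ⟨b, u⟩ ⟨c, v⟩ h
    simpa using h
  rw [← ENNReal.tsum_prod, ← tsum_range (f := f) hinj, ← h1,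
    ← (ENNReal.summable.tsum_add_tsum_compl (s := {[]}) ENNReal.summable)]
  simp

/-- The family on `List ℕ` whose value at `[]` is the first component and whose subfamilies at the
children of `[]` are given by the second. -/
def List.glue {X : Type*} (z : X × (ℕ → List ℕ → X)) : List ℕ → X
  | [] => z.1
  | b :: u => z.2 b u

theorem List.measurable_glue {X : Type*} [MeasurableSpace X] :
    Measurable (List.glue : X × (ℕ → List ℕ → X) → List ℕ → X) := by
  refine measurable_pi_lambda _ fun u => ?_
  rcases u with _ | ⟨b, u⟩
  · exact measurable_fst
  · exact (measurable_pi_apply u).comp ((measurable_pi_apply b).comp measurable_snd)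

/-- The branching property at the level of families: every nonempty word is uniquely a first letter
followed by a word, so an i.i.d. family on words is a root value together with independent i.i.d.
families, one for each first letter. -/
theorem List.map_glue {X : Type*} [MeasurableSpace X] (ν : Measure X) [IsProbabilityMeasure ν] :
    (ν.prod (Measure.infinitePi fun _ : ℕ => Measure.infinitePi fun _ : List ℕ => ν)).map
      List.glue = Measure.infinitePi fun _ : List ℕ => ν := by
  classical
  refine Measure.eq_infinitePi _ fun s t ht => ?_
  let c : ℕ × List ℕ → List ℕ := fun x => x.1 :: x.2
  have hinj : Function.Injective c := by
    rintro ⟨b, u⟩ ⟨d, v⟩ h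
    simpa [c] using h
  let s' : Finset (ℕ × List ℕ) := s.preimage c hinj.injOn
  have hpre : List.glue ⁻¹' (Set.pi s t) =
      {a : X | [] ∈ s → a ∈ t []} ×ˢ
        ((MeasurableEquiv.curry ℕ (List ℕ) X).symm ⁻¹' Set.pi s' (fun x => t (c x))) := by
    ext ⟨a, y⟩
    simp only [Set.mem_preimage, Set.mem_pi, Set.mem_prod, Set.mem_ofPred_eq, Finset.mem_coe, s',
      Finset.mem_preimage]
    constructor
    · exact fun h => ⟨h [], fun x hx => h _ hx⟩
    · rintro ⟨h1, h2⟩ (_ | ⟨b, u⟩) hu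
      · exact h1 hu
      · exact h2 (b, u) hu
  rw [Measure.map_apply List.measurable_glue
    (MeasurableSet.pi (Finset.countable_toSet s) fun i _ => ht i), hpre, Measure.prod_prod,
    ← Measure.map_apply (MeasurableEquiv.measurable _)
      (MeasurableSet.pi (Finset.countable_toSet s') fun i _ => ht _),
    Measure.infinitePi_map_curry_symm (fun _ _ => ν), Measure.infinitePi_pi _ fun i _ => ht _]
  have hprod : ∏ x ∈ s', ν (t (c x)) = ∏ u ∈ s with u ≠ [], ν (t u) := by
    refine Finset.prod_bij (fun x _ => c x) ?_ (fun _ _ _ _ h => hinj h) ?_ (fun _ _ => rfl)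
    · intro x hx
      simpa [s', c] using hx
    · rintro (_ | ⟨b, u⟩) hu
      · simp at hu
      · exact ⟨(b, u), by simpa [s', c] using hu, rfl⟩
  rw [hprod]
  by_cases h : [] ∈ s
  · have : {u ∈ s | u ≠ []} = s.erase [] := by ext; simp [and_comm]
    rw [this, ← Finset.mul_prod_erase s _ h]
    simp [h]
  · have : {u ∈ s | u ≠ []} = s := Finset.filter_true_of_mem fun u hu hc => h (hc ▸ hu)
    rw [this]
    simp [h]

/-- Binomial and multinomial expansion, then independence. The copies are indexed by all of `ℕ`, so
that a single product measure serves every offspring number `k`. -/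
theorem lintegral_add_sum_pow {Y : Type*} [MeasurableSpace Y] (μ : Measure Y)
    [IsProbabilityMeasure μ] {M : Y → ℝ≥0∞} (hM : Measurable M) (c : ℝ≥0∞) (k i : ℕ) :
    ∫⁻ y, (c + ∑ b : Fin k, M (y b)) ^ i ∂(Measure.infinitePi fun _ : ℕ => μ) =
      ∑ j ∈ Finset.range (i + 1), (i.choose j : ℝ≥0∞) * c ^ (i - j) *
        ∑ a ∈ Finset.piAntidiag (Finset.univ : Finset (Fin k)) j,
          (Nat.multinomial Finset.univ a : ℝ≥0∞) * ∏ b : Fin k, ∫⁻ y, M y ^ (a b) ∂μ := by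
  have hm : ∀ b : ℕ, Measurable fun y : ℕ → Y => M (y b) := fun b =>
    hM.comp (measurable_pi_apply b)
  have hprod : ∀ a : Fin k → ℕ,
      ∫⁻ y, ∏ b : Fin k, M (y b) ^ (a b) ∂(Measure.infinitePi fun _ : ℕ => μ) =
        ∏ b : Fin k, ∫⁻ y, M y ^ (a b) ∂μ := by
    intro a
    have hind : ProbabilityTheory.iIndepFun (fun (b : Fin k) (y : ℕ → Y) => M (y b) ^ (a b))
        (Measure.infinitePi fun _ : ℕ => μ) := by
      have h0 : ProbabilityTheory.iIndepFun (fun (b : ℕ) (y : ℕ → Y) => M (y b))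
          (Measure.infinitePi fun _ : ℕ => μ) :=
        ProbabilityTheory.iIndepFun_infinitePi fun _ => hM
      exact (h0.precomp Fin.val_injective).comp (fun b x => x ^ (a b)) fun b => by fun_prop
    rw [ProbabilityTheory.lintegral_prod_eq_prod_lintegral_of_indepFun _ _ hind
      fun b => (hm b).pow_const _]
    refine Finset.prod_congr rfl fun b _ => ?_
    have := lintegral_map (μ := Measure.infinitePi fun _ : ℕ => μ)
      (hM.pow_const (a b)) (measurable_pi_apply (b : ℕ))
    rw [← this, Measure.infinitePi_map_eval]
  have hmp : ∀ a : Fin k → ℕ, Measurable fun y : ℕ → Y => ∏ b : Fin k, M (y b) ^ (a b) :=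
    fun a => Finset.measurable_fun_prod _ fun b _ => (hm b).pow_const _
  simp_rw [add_comm c, add_pow, Finset.sum_pow_eq_sum_piAntidiag]
  rw [lintegral_finsetSum _ fun j _ => ?_]
  · refine Finset.sum_congr rfl fun j _ => ?_
    simp_rw [mul_assoc]
    rw [lintegral_mul_const _ ?_, lintegral_finsetSum _ fun a _ => ?_]
    · simp_rw [lintegral_const_mul _ (hmp _), hprod]
      ring
    · exact (hmp a).const_mul _
    · exact Finset.measurable_fun_sum _ fun a _ => (hmp a).const_mul _
  · refine Measurable.mul_const (Measurable.mul_const ?_ _) _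
    exact Finset.measurable_fun_sum _ fun a _ => (hmp a).const_mul _

namespace MarkedTree

/-- The number of marked vertices of generations less than `N`. -/
noncomputable def marksBelow (N : ℕ∞) (t : MarkedTree) : ℝ≥0∞ :=
  ∑' u : List ℕ, {v | t.mark v = true ∧ (v.length : ℕ∞) < N}.indicator 1 u

theorem marksBelow_top (t : MarkedTree) : t.marksBelow ⊤ = (t.totalMarks : ℝ≥0∞) := by
  rw [marksBelow, totalMarks, ← ENNReal.tsum_set_one, ← tsum_subtype]
  simp

theorem marksBelow_zero (t : MarkedTree) : t.marksBelow 0 = 0 := by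
  simp [marksBelow]

theorem marksBelow_mono (t : MarkedTree) : Monotone fun N => t.marksBelow N := by
  intro M N h
  refine ENNReal.tsum_le_tsum fun u => Set.indicator_le_indicator_of_subset ?_ (by simp) u
  exact fun v hv => ⟨hv.1, hv.2.trans_le h⟩

/-- A finite partial sum only involves words of bounded length. -/
theorem iSup_marksBelow (t : MarkedTree) : ⨆ n : ℕ, t.marksBelow n = t.marksBelow ⊤ := by
  refine le_antisymm (iSup_le fun n => t.marksBelow_mono le_top) ?_
  rw [marksBelow, ENNReal.tsum_eq_iSup_sum]
  refine iSup_le fun s => ?_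
  refine le_iSup_of_le (s.sup List.length + 1) (le_trans ?_ (ENNReal.sum_le_tsum s))
  refine Finset.sum_le_sum fun u hu => ?_
  have hl : (u.length : ℕ∞) < ((s.sup List.length + 1 : ℕ) : ℕ∞) :=
    Nat.cast_lt.mpr (Nat.lt_succ_of_le (Finset.le_sup (f := List.length) hu))
  by_cases h : t.mark u = true
  · simp only [Set.indicator, Set.mem_ofPred_eq, h, hl, true_and]
    split_ifs <;> simp
  · simp [h]

theorem measurable_marksBelow (N : ℕ∞) : Measurable (marksBelow N) := by
  refine Measurable.tsum fun u => ?_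
  have : (fun t : MarkedTree =>
      ({v | t.mark v = true ∧ (v.length : ℕ∞) < N}.indicator 1 u : ℝ≥0∞)) =
      ({t : MarkedTree | t.mark u = true} ∩ {_t | (u.length : ℕ∞) < N}).indicator 1 := by
    ext t
    simp [Set.indicator]
  rw [this]
  exact measurable_one.indicator ((measurableSet_mark u).inter (MeasurableSet.const _))

/-- Allowing `N` in `ℕ∞` covers two uses at once: for finite `N` a recursion on truncated counts,
and for `N = ⊤`, where `⊤ + 1 = ⊤`, the fixed-point equation for `M_∞`. -/
theorem marksBelow_ofFamily_glue (N : ℕ∞) (a : ℕ × Bool) (y : ℕ → List ℕ → ℕ × Bool) :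
    (ofFamily (List.glue (a, y))).marksBelow (N + 1) =
      a.2.toNat + ∑ b : Fin a.1, (ofFamily (y b)).marksBelow N := by
  rw [marksBelow, ENNReal.tsum_list]
  congr 1
  · have h : (ofFamily (List.glue (a, y))).mark [] = a.2 := mark_ofFamily (nil_mem _)
    have h0 : (0 : ℕ∞) < N + 1 := by simp
    simp only [Set.indicator, Set.mem_ofPred_eq, h, List.length_nil, Nat.cast_zero, h0, and_true]
    cases a.2 <;> simp
  · have hterm : ∀ b : ℕ, ∑' u : List ℕ,
        ({v | (ofFamily (List.glue (a, y))).mark v = true ∧ (v.length : ℕ∞) < N + 1}.indicator 1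
          (b :: u) : ℝ≥0∞) = if b < a.1 then (ofFamily (y b)).marksBelow N else 0 := by
      intro b
      have hmark : ∀ u : List ℕ, ((ofFamily (List.glue (a, y))).mark (b :: u) = true ↔
          b < a.1 ∧ (ofFamily (y b)).mark u = true) := by
        intro u
        rw [mark_ofFamily_eq_true_iff, mark_ofFamily_eq_true_iff, cons_mem_ofFamily]
        change _ ∧ b < a.1 ∧ u ∈ (ofFamily (y b)).nodes ↔ _
        change (y b u).2 = true ∧ _ ↔ _
        tauto
      have hlen : ∀ u : List ℕ, (((b :: u).length : ℕ) : ℕ∞) < N + 1 ↔ (u.length : ℕ∞) < N := by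
        intro u
        rw [List.length_cons, Nat.cast_add, Nat.cast_one]
        exact ENat.add_lt_add_iff_right (by simp)
      split_ifs with hb
      · refine tsum_congr fun u => ?_
        simp only [Set.indicator, Set.mem_ofPred_eq, hmark, hlen, hb, true_and,
          Pi.one_apply]
      · simp only [Set.indicator, Set.mem_ofPred_eq, hmark, hb, false_and, if_false, tsum_zero]
    simp_rw [hterm]
    rw [tsum_eq_sum (s := Finset.range a.1) (fun b hb => by simp at hb; simp [hb]),
      ← Fin.sum_univ_eq_sum_range (fun b => if b < a.1 then (ofFamily (y b)).marksBelow N else 0)]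
    simp

end MarkedTree

/-! ### Bounds on mixed moments -/

/-- The mixed moment `∑ j, (i choose j) c^(i-j) ∑ a, (j choose a) ∏ b, e (a b)`, the moment of order
`i` of `c` plus the sum of `k` independent variables with moments `e`. -/
noncomputable def mixedMoment (e : ℕ → ℝ≥0∞) (c : ℝ≥0∞) (k i : ℕ) : ℝ≥0∞ :=
  ∑ j ∈ Finset.range (i + 1), (i.choose j : ℝ≥0∞) * c ^ (i - j) *
    ∑ a ∈ Finset.piAntidiag (Finset.univ : Finset (Fin k)) j,
      (Nat.multinomial Finset.univ a : ℝ≥0∞) * ∏ b : Fin k, e (a b)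

theorem multinomial_pi_single {ι : Type*} [Fintype ι] [DecidableEq ι] (b : ι) (i : ℕ) :
    Nat.multinomial Finset.univ (Pi.single b i : ι → ℕ) = 1 := by
  have h := Nat.multinomial_spec Finset.univ (Pi.single b i : ι → ℕ)
  have h1 : ∏ c, ((Pi.single b i : ι → ℕ) c)! = i ! := by
    rw [Finset.prod_eq_single b] <;> simp +contextual
  have h2 : ∑ c, (Pi.single b i : ι → ℕ) c = i := by simp
  rw [h1, h2] at h
  exact Nat.eq_of_mul_eq_mul_left i.factorial_pos (h.trans (mul_one _).symm)

/-- The top moment `e i` occurs only when one index carries all of `i`, with multinomial coefficient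
`1`; otherwise every exponent is below `i` and `C` applies. The gain is that `e i` comes with the
exact factor `k`, whose mean is less than `1`. -/
theorem sum_multinomial_mul_prod_le {e : ℕ → ℝ≥0∞} {C : ℝ≥0∞} {i : ℕ}
    (hi : 0 < i) (he : ∀ j < i, e j ≤ C ^ j) (k : ℕ) :
    ∑ a ∈ Finset.piAntidiag (Finset.univ : Finset (Fin k)) i,
      (Nat.multinomial Finset.univ a : ℝ≥0∞) * ∏ b : Fin k, e (a b) ≤ (C * k) ^ i + k * e i := by
  have hpow : (C * k) ^ i = ∑ a ∈ Finset.piAntidiag (Finset.univ : Finset (Fin k)) i,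
      (Nat.multinomial Finset.univ a : ℝ≥0∞) * ∏ b : Fin k, C ^ (a b) := by
    rw [← Finset.sum_pow_eq_sum_piAntidiag]
    simp [mul_comm]
  have hk : (k : ℝ≥0∞) * e i = ∑ a ∈ Finset.piAntidiag (Finset.univ : Finset (Fin k)) i,
      (Nat.multinomial Finset.univ a : ℝ≥0∞) * ∑ b : Fin k, if a = Pi.single b i then e i else 0 := by
    simp_rw [Finset.mul_sum]
    rw [Finset.sum_comm]
    have : ∀ b : Fin k, ∑ a ∈ Finset.piAntidiag (Finset.univ : Finset (Fin k)) i,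
        (Nat.multinomial Finset.univ a : ℝ≥0∞) * (if a = Pi.single b i then e i else 0) = e i := by
      intro b
      rw [Finset.sum_eq_single (Pi.single b i)]
      · simp [multinomial_pi_single]
      · intro a _ h; simp [h]
      · intro h; exact absurd (by simp [Finset.mem_piAntidiag]) h
    rw [Finset.sum_congr rfl fun b _ => this b]
    simp
  rw [hpow, hk, ← Finset.sum_add_distrib]
  simp_rw [← mul_add]
  refine Finset.sum_le_sum fun a ha => mul_le_mul_right ?_ _
  have hs : ∑ b, a b = i := (Finset.mem_piAntidiag.mp ha).1
  by_cases h : ∃ b, a b = i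
  · obtain ⟨b, hb⟩ := h
    have hz : ∀ c, c ≠ b → a c = 0 := by
      intro c hc
      have := Finset.add_sum_erase Finset.univ a (Finset.mem_univ b)
      have h0 : ∑ x ∈ Finset.univ.erase b, a x = 0 := by omega
      exact Finset.sum_eq_zero_iff.mp h0 c (by simp [hc])
    have ha' : a = Pi.single b i := by
      ext c
      by_cases hc : c = b
      · subst hc; simp [hb]
      · simp [hc, hz c hc]
    have hone : ∀ c, c ≠ b → e (a c) ≤ 1 := fun c hc => by
      simpa [hz c hc] using he 0 hi
    refine le_add_left ?_
    calc ∏ c, e (a c) = e (a b) * ∏ c ∈ Finset.univ.erase b, e (a c) :=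
          (Finset.mul_prod_erase _ _ (Finset.mem_univ b)).symm
      _ ≤ e i * 1 := by
          rw [hb]
          exact mul_le_mul_right (Finset.prod_le_one' fun c hc => hone c (Finset.ne_of_mem_erase hc)) _
      _ ≤ _ := by
          rw [mul_one]
          refine le_trans ?_ (Finset.single_le_sum (fun _ _ => zero_le) (Finset.mem_univ b))
          simp [ha']
  · push Not at h
    refine le_add_right (Finset.prod_le_prod' fun b _ => he _ ?_)
    exact lt_of_le_of_ne (hs ▸ Finset.single_le_sum (fun _ _ => Nat.zero_le _) (Finset.mem_univ b))
      (h b)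

theorem mixedMoment_le {e : ℕ → ℝ≥0∞} {C c : ℝ≥0∞} {i : ℕ} (hi : 0 < i)
    (he : ∀ j < i, e j ≤ C ^ j) (hc : c ≤ 1) (k : ℕ) :
    mixedMoment e c k i ≤ (C * k + 1) ^ i + k * e i := by
  rw [mixedMoment, add_pow, Finset.sum_range_succ, Finset.sum_range_succ, add_assoc]
  refine add_le_add (Finset.sum_le_sum fun j hj => ?_) ?_
  · have hj := Finset.mem_range.mp hj
    rw [one_pow, mul_one, mul_comm ((C * k) ^ j)]
    refine mul_le_mul' (mul_le_of_le_one_right' (pow_le_one' hc _)) ?_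
    have hpow : (C * k) ^ j = ∑ a ∈ Finset.piAntidiag (Finset.univ : Finset (Fin k)) j,
        (Nat.multinomial Finset.univ a : ℝ≥0∞) * ∏ b : Fin k, C ^ (a b) := by
      rw [← Finset.sum_pow_eq_sum_piAntidiag]
      simp [mul_comm]
    rw [hpow]
    refine Finset.sum_le_sum fun a ha => mul_le_mul_right (Finset.prod_le_prod' fun b _ =>
      he _ (lt_of_le_of_lt ?_ hj)) _
    rw [← (Finset.mem_piAntidiag.mp ha).1]
    exact Finset.single_le_sum (fun _ _ => Nat.zero_le _) (Finset.mem_univ b)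
  · simpa using sum_multinomial_mul_prod_le hi he k

theorem one_le_mixedMoment {e : ℕ → ℝ≥0∞} (he : e 0 = 1) (k i : ℕ) : 1 ≤ mixedMoment e 1 k i := by
  refine le_trans ?_ (Finset.single_le_sum (fun _ _ => zero_le)
    (Finset.mem_range.mpr (Nat.succ_pos i)))
  simp [he, Nat.multinomial]

theorem ofReal_factorial_mul_coeff_momentSeries {x : ℕ → ℝ} (hx : ∀ j, 0 ≤ x j) {s : ℝ}
    (hs : 0 ≤ s) (k i : ℕ) :
    ENNReal.ofReal ((i ! : ℝ) * PowerSeries.coeff i (momentSeries x s k)) =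
      mixedMoment (fun j => ENNReal.ofReal (x j)) (ENNReal.ofReal s) k i := by
  have hp : ∀ a : Fin k → ℕ, 0 ≤ (Nat.multinomial Finset.univ a : ℝ) * ∏ b : Fin k, x (a b) :=
    fun a => mul_nonneg (Nat.cast_nonneg _) (Finset.prod_nonneg fun b _ => hx _)
  have hsum : ∀ j, 0 ≤ ∑ a ∈ Finset.piAntidiag (Finset.univ : Finset (Fin k)) j,
      (Nat.multinomial Finset.univ a : ℝ) * ∏ b : Fin k, x (a b) :=
    fun j => Finset.sum_nonneg fun a _ => hp a
  have hc : ∀ j, 0 ≤ (i.choose j : ℝ) * s ^ (i - j) := fun j => by positivity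
  rw [factorial_mul_coeff_momentSeries, mixedMoment,
    ENNReal.ofReal_sum_of_nonneg fun j _ => mul_nonneg (hc j) (hsum j)]
  refine Finset.sum_congr rfl fun j _ => ?_
  rw [ENNReal.ofReal_mul (hc j), ENNReal.ofReal_mul (Nat.cast_nonneg _), ENNReal.ofReal_natCast,
    ENNReal.ofReal_pow hs, ENNReal.ofReal_sum_of_nonneg fun a _ => hp a]
  congr 1
  refine Finset.sum_congr rfl fun a _ => ?_
  rw [ENNReal.ofReal_mul (Nat.cast_nonneg _), ENNReal.ofReal_natCast,
    ENNReal.ofReal_prod_of_nonneg fun b _ => hx _]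

theorem mixedMoment_congr {e e' : ℕ → ℝ≥0∞} {i : ℕ} (h : ∀ j ≤ i, e j = e' j) (c : ℝ≥0∞) (k : ℕ) :
    mixedMoment e c k i = mixedMoment e' c k i := by
  refine Finset.sum_congr rfl fun j hj => ?_
  have hj := Nat.lt_succ_iff.mp (Finset.mem_range.mp hj)
  congr 1
  refine Finset.sum_congr rfl fun a ha => ?_
  congr 1
  refine Finset.prod_congr rfl fun b _ => h _ (le_trans ?_ hj)
  rw [← (Finset.mem_piAntidiag.mp ha).1]
  exact Finset.single_le_sum (fun _ _ => Nat.zero_le _) (Finset.mem_univ b)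

theorem reproMarkLaw_apply (p : PMF ℕ) (q : ℕ → unitInterval) (x : ℕ × Bool) :
    reproMarkLaw p q x =
      p x.1 * ENNReal.ofReal (if x.2 then (q x.1 : ℝ) else 1 - (q x.1 : ℝ)) := rfl

theorem tsum_reproMarkLaw_mul (p : PMF ℕ) (q : ℕ → unitInterval) (g : ℕ → ℝ≥0∞) :
    ∑' x : ℕ × Bool, reproMarkLaw p q x * g x.1 = ∑' k, p k * g k := by
  rw [ENNReal.tsum_prod']
  refine tsum_congr fun k => ?_
  have hk : ENNReal.ofReal (1 - (q k : ℝ)) + ENNReal.ofReal (q k : ℝ) = 1 := by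
    rw [← ENNReal.ofReal_add (sub_nonneg.mpr (q k).2.2) (q k).2.1]
    simp
  rw [tsum_bool]
  simp only [reproMarkLaw_apply, Bool.false_eq_true, if_false, if_true]
  rw [← add_mul, ← mul_add, hk, mul_one]

theorem lintegral_reproMarkLaw (p : PMF ℕ) (q : ℕ → unitInterval) (g : ℕ × Bool → ℝ≥0∞) :
    ∫⁻ x, g x ∂(reproMarkLaw p q).toMeasure = ∑' x, reproMarkLaw p q x * g x := by
  rw [lintegral_countable']
  refine tsum_congr fun x => ?_
  rw [PMF.toMeasure_apply_singleton _ _ (measurableSet_singleton x), mul_comm]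

/-! ### Finiteness and positivity of the moments of the number of marks -/

section Moments

variable (p : PMF ℕ) (q : ℕ → unitInterval)

instance : IsProbabilityMeasure (markedGaltonWatson p q) :=
  Measure.isProbabilityMeasure_map MarkedTree.measurable_ofFamily.aemeasurable

/-- The moment of order `i` of the number of marked vertices of generations less than `N`. -/
noncomputable def markMoment (N : ℕ∞) (i : ℕ) : ℝ≥0∞ :=
  ∫⁻ t, t.marksBelow N ^ i ∂(markedGaltonWatson p q)

theorem xi_eq (i : ℕ) : xi p q i = (markMoment p q ⊤ i).toReal := by
  simp only [xi, markMoment, MarkedTree.marksBelow_top]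

theorem markMoment_zero_right (N : ℕ∞) : markMoment p q N 0 = 1 := by
  simp [markMoment]

theorem xi_zero : xi p q 0 = 1 := by
  rw [xi_eq, markMoment_zero_right, ENNReal.toReal_one]

theorem markMoment_mono {M N : ℕ∞} (h : M ≤ N) (i : ℕ) :
    markMoment p q M i ≤ markMoment p q N i :=
  lintegral_mono fun t => pow_le_pow_left' (t.marksBelow_mono h) i

theorem markMoment_top (i : ℕ) : markMoment p q ⊤ i = ⨆ n : ℕ, markMoment p q n i := by
  simp only [markMoment]
  rw [← lintegral_iSup]
  · simp_rw [← MarkedTree.iSup_marksBelow, ENNReal.iSup_pow]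
  · exact fun n => (MarkedTree.measurable_marksBelow _).pow_const i
  · exact fun m n h t => pow_le_pow_left' (t.marksBelow_mono (Nat.cast_le.mpr h)) i

/-- The branching equation for moments: condition on the offspring number and mark of the root, and
expand the power of its mark plus the counts in its independent subtrees. -/
theorem markMoment_add_one (N : ℕ∞) (i : ℕ) :
    markMoment p q (N + 1) i =
      ∑' x, reproMarkLaw p q x * mixedMoment (markMoment p q N) x.2.toNat x.1 i := by
  have hm : Measurable fun t : MarkedTree => t.marksBelow (N + 1) ^ i :=
    (MarkedTree.measurable_marksBelow _).pow_const i
  have hm' : Measurable fun x : List ℕ → ℕ × Bool =>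
      (MarkedTree.ofFamily x).marksBelow (N + 1) ^ i := hm.comp MarkedTree.measurable_ofFamily
  have hg : Measurable fun z : (ℕ × Bool) × (ℕ → List ℕ → ℕ × Bool) =>
      (MarkedTree.ofFamily (List.glue z)).marksBelow (N + 1) ^ i := hm'.comp List.measurable_glue
  have hM : Measurable fun x : List ℕ → ℕ × Bool => (MarkedTree.ofFamily x).marksBelow N :=
    (MarkedTree.measurable_marksBelow _).comp MarkedTree.measurable_ofFamily
  rw [markMoment, markedGaltonWatson, lintegral_map hm MarkedTree.measurable_ofFamily,
    ← List.map_glue, lintegral_map hm' List.measurable_glue,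
    lintegral_prod _ hg.aemeasurable, lintegral_reproMarkLaw]
  refine tsum_congr fun x => ?_
  simp_rw [MarkedTree.marksBelow_ofFamily_glue]
  rw [lintegral_add_sum_pow _ hM, mixedMoment]
  have he : ∀ j, ∫⁻ y, (MarkedTree.ofFamily y).marksBelow N ^ j
      ∂(Measure.infinitePi fun _ : List ℕ => (reproMarkLaw p q).toMeasure) =
        markMoment p q N j := by
    intro j
    rw [markMoment, markedGaltonWatson, lintegral_map
      ((MarkedTree.measurable_marksBelow _).pow_const j) MarkedTree.measurable_ofFamily]
  simp_rw [he]

variable {p q}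

theorem tsum_add_one_pow_lt_top {ℓ i : ℕ} (hi : i ≤ ℓ)
    (hmom : ∑' k : ℕ, (k : ℝ≥0∞) ^ ℓ * p k < ∞) {C : ℝ≥0∞} (hC : C ≠ ∞) :
    ∑' k : ℕ, p k * (C * k + 1) ^ i < ∞ := by
  have hle : ∀ k : ℕ, p k * (C * k + 1) ^ i ≤ (C + 1) ^ ℓ * (p k + (k : ℝ≥0∞) ^ ℓ * p k) := by
    intro k
    have h1 : (C * k + 1) ^ i ≤ (C * k + 1) ^ ℓ := pow_le_pow_right' (le_add_left le_rfl) hi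
    have h2 : (C * k + 1) ^ ℓ ≤ (C + 1) ^ ℓ * (1 + (k : ℝ≥0∞) ^ ℓ) := by
      rcases Nat.eq_zero_or_pos k with rfl | hk
      · simp only [Nat.cast_zero, mul_zero, zero_add, one_pow]
        exact one_le_mul (one_le_pow_of_one_le' (le_add_left le_rfl) _) (le_add_right le_rfl)
      · have hk : (1 : ℝ≥0∞) ≤ k := by exact_mod_cast hk
        calc (C * k + 1) ^ ℓ ≤ ((C + 1) * k) ^ ℓ := by
              refine pow_le_pow_left' ?_ _
              rw [add_mul, one_mul]
              gcongr
          _ = (C + 1) ^ ℓ * (k : ℝ≥0∞) ^ ℓ := mul_pow _ _ _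
          _ ≤ _ := by gcongr; exact le_add_left le_rfl
    calc p k * (C * k + 1) ^ i ≤ p k * ((C + 1) ^ ℓ * (1 + (k : ℝ≥0∞) ^ ℓ)) := by
          gcongr; exact h1.trans h2
      _ = _ := by ring
  refine (ENNReal.tsum_le_tsum hle).trans_lt ?_
  rw [ENNReal.tsum_mul_left, ENNReal.tsum_add, p.tsum_coe]
  exact ENNReal.mul_lt_top (ENNReal.pow_lt_top (ENNReal.add_lt_top.mpr ⟨hC.lt_top, by simp⟩))
    (ENNReal.add_lt_top.mpr ⟨by simp, hmom⟩)

/-- Induction on the order. Given finite lower moments, the truncated moments satisfy `x_{n+1} ≤ K +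
m x_n` with `m < 1` the mean offspring number and `x_0 = 0`, hence are bounded. Truncation is
essential, since `x ≤ K + m x` does not exclude `x = ∞`. -/
theorem markMoment_top_lt_top {ℓ : ℕ} (hsub : ∑' k : ℕ, (k : ℝ≥0∞) * p k < 1)
    (hmom : ∑' k : ℕ, (k : ℝ≥0∞) ^ ℓ * p k < ∞) {i : ℕ} (hi : i ≤ ℓ) :
    markMoment p q ⊤ i < ∞ := by
  induction i using Nat.strong_induction_on with
  | _ i ih =>
    rcases Nat.eq_zero_or_pos i with rfl | hpos
    · simp [markMoment_zero_right]
    -- `C` dominates every lower moment and is at least `1`, so its `j`-th power dominates the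
    -- moment of order `j` for `1 ≤ j < i`; for `j = 0` both are `1`.
    set C : ℝ≥0∞ := 1 + ∑ j ∈ Finset.range i, markMoment p q ⊤ j with hC
    have hCtop : C ≠ ∞ := by
      refine (ENNReal.add_lt_top.mpr ⟨by simp, ENNReal.sum_lt_top.mpr fun j hj => ?_⟩).ne
      have hj := Finset.mem_range.mp hj
      exact ih j hj (hj.le.trans hi)
    have hbound : ∀ (N : ℕ∞), ∀ j < i, markMoment p q N j ≤ C ^ j := by
      intro N j hj
      rcases Nat.eq_zero_or_pos j with rfl | hj0
      · simp [markMoment_zero_right]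
      · refine (markMoment_mono p q le_top j).trans ?_
        have h1 : markMoment p q ⊤ j ≤ C := by
          refine le_add_left ?_
          exact Finset.single_le_sum (f := fun j => markMoment p q ⊤ j)
            (fun _ _ => zero_le) (Finset.mem_range.mpr hj)
        exact h1.trans (le_self_pow (le_add_right le_rfl) hj0.ne')
    set K : ℝ≥0∞ := ∑' k : ℕ, p k * (C * k + 1) ^ i with hK
    have hKtop : K < ∞ := tsum_add_one_pow_lt_top hi hmom hCtop
    set m : ℝ≥0∞ := ∑' k : ℕ, (k : ℝ≥0∞) * p k with hm
    have hstep : ∀ n : ℕ, markMoment p q (n + 1 : ℕ) i ≤ K + m * markMoment p q n i := by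
      intro n
      rw [Nat.cast_add, Nat.cast_one, markMoment_add_one]
      calc _ ≤ ∑' x : ℕ × Bool, reproMarkLaw p q x *
            ((C * x.1 + 1) ^ i + x.1 * markMoment p q n i) := by
            refine ENNReal.tsum_le_tsum fun x => ?_
            gcongr
            refine mixedMoment_le hpos (hbound _) ?_ _
            cases x.2 <;> simp
        _ = K + m * markMoment p q n i := by
            rw [tsum_reproMarkLaw_mul p q fun k => (C * k + 1) ^ i + k * markMoment p q n i]
            simp_rw [mul_add]
            rw [ENNReal.tsum_add, ← ENNReal.tsum_mul_right]
            congr 1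
            exact tsum_congr fun k => by ring
    -- `B = K / (1 - m)` is the fixed point of `x ↦ K + m x`, finite because `m < 1`; the recursion
    -- started at `0` stays below it.
    set B : ℝ≥0∞ := K * (1 - m)⁻¹ with hB
    have hm0 : 1 - m ≠ 0 := (tsub_pos_iff_lt.mpr hsub).ne'
    have hm1 : 1 - m ≠ ∞ := ENNReal.sub_ne_top ENNReal.one_ne_top
    have hBK : K + m * B = B := by
      have h1 : (1 - m) * B = K := by
        rw [hB, mul_left_comm, ENNReal.mul_inv_cancel hm0 hm1, mul_one]
      calc K + m * B = (1 - m) * B + m * B := by rw [h1]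
        _ = B := by rw [← add_mul, tsub_add_cancel_of_le hsub.le, one_mul]
    have hle : ∀ n : ℕ, markMoment p q n i ≤ B := by
      intro n
      induction n with
      | zero => simp [markMoment, MarkedTree.marksBelow_zero, hpos.ne']
      | succ n ihn =>
        refine (hstep n).trans ?_
        conv_rhs => rw [← hBK]
        gcongr
    rw [markMoment_top]
    exact (iSup_le hle).trans_lt (ENNReal.mul_lt_top hKtop (ENNReal.inv_lt_top.mpr hm0.bot_lt))

/-- With positive probability the root is marked, and then the number of marks is at least `1`. -/
theorem markMoment_top_pos (hq : ∃ k : ℕ, 0 < (p k).toReal * (q k : ℝ)) (i : ℕ) :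
    0 < markMoment p q ⊤ i := by
  obtain ⟨k, hk⟩ := hq
  have h := markMoment_add_one p q ⊤ i
  rw [top_add] at h
  rw [h]
  have hpk : 0 < reproMarkLaw p q (k, true) := by
    have h1 : 0 < (p k).toReal := by
      by_contra hc
      have : (p k).toReal = 0 := le_antisymm (not_lt.mp hc) ENNReal.toReal_nonneg
      simp [this] at hk
    have h2 : 0 < (q k : ℝ) := pos_of_mul_pos_right hk h1.le
    simp only [reproMarkLaw_apply, if_true]
    exact ENNReal.mul_pos (ENNReal.toReal_pos_iff.mp h1).1.ne' (ENNReal.ofReal_pos.mpr h2).ne'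
  refine hpk.trans_le (le_trans ?_ (ENNReal.le_tsum ((k, true) : ℕ × Bool)))
  refine le_mul_of_one_le_right' ?_
  simpa using one_le_mixedMoment (markMoment_zero_right p q ⊤) k i

end Moments

/-! ### Normalisation of `p_i` and `γ`, and the one-generation identity -/

section TypedLaw

variable {p : PMF ℕ} {q : ℕ → unitInterval} {ℓ : ℕ}

theorem xi_pos (hsub : ∑' k : ℕ, (k : ℝ≥0∞) * p k < 1)
    (hmom : ∑' k : ℕ, (k : ℝ≥0∞) ^ ℓ * p k < ∞)
    (hq : ∃ k : ℕ, 0 < (p k).toReal * (q k : ℝ)) {i : ℕ} (hi : i ≤ ℓ) : 0 < xi p q i := by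
  rw [xi_eq]
  exact ENNReal.toReal_pos (markMoment_top_pos hq i).ne' (markMoment_top_lt_top hsub hmom hi).ne

theorem ofReal_xi (hsub : ∑' k : ℕ, (k : ℝ≥0∞) * p k < 1)
    (hmom : ∑' k : ℕ, (k : ℝ≥0∞) ^ ℓ * p k < ∞) {i : ℕ} (hi : i ≤ ℓ) :
    ENNReal.ofReal (xi p q i) = markMoment p q ⊤ i := by
  rw [xi_eq, ENNReal.ofReal_toReal (markMoment_top_lt_top hsub hmom hi).ne]

/-- The branching equation at `N = ⊤`, divided by `i!`. It is the normalisation of `p_i` for a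
vertex of mass `0`. -/
theorem tsum_reproMarkLaw_mul_coeff (hsub : ∑' k : ℕ, (k : ℝ≥0∞) * p k < 1)
    (hmom : ∑' k : ℕ, (k : ℝ≥0∞) ^ ℓ * p k < ∞) {i : ℕ} (hi : i ≤ ℓ) :
    ∑' x, reproMarkLaw p q x *
      ENNReal.ofReal (PowerSeries.coeff i (momentSeries (xi p q) (x.2.toNat : ℝ) x.1)) =
      ENNReal.ofReal (PowerSeries.coeff i (momentSeries (xi p q) 0 1)) := by
  have hfac : ∀ c : ℝ, ENNReal.ofReal c =
      ENNReal.ofReal ((i ! : ℝ)⁻¹) * ENNReal.ofReal ((i ! : ℝ) * c) := by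
    intro c
    rw [← ENNReal.ofReal_mul (by positivity), inv_mul_cancel_left₀]
    exact Nat.cast_ne_zero.mpr i.factorial_ne_zero
  have hx : ∀ x : ℕ × Bool, ENNReal.ofReal ((i ! : ℝ) *
      PowerSeries.coeff i (momentSeries (xi p q) (x.2.toNat : ℝ) x.1)) =
        mixedMoment (markMoment p q ⊤) x.2.toNat x.1 i := by
    intro x
    rw [ofReal_factorial_mul_coeff_momentSeries (xi_nonneg p q) (Nat.cast_nonneg _),
      ENNReal.ofReal_natCast]
    exact mixedMoment_congr (fun j hj => ofReal_xi hsub hmom (hj.trans hi)) _ _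
  have htop := markMoment_add_one p q ⊤ i
  rw [top_add] at htop
  simp_rw [hfac (PowerSeries.coeff i _), hx, mul_left_comm _ (ENNReal.ofReal ((i ! : ℝ)⁻¹))]
  rw [ENNReal.tsum_mul_left, ← htop, coeff_momentSeries_zero_one, mul_div_cancel₀,
    ofReal_xi hsub hmom hi]
  exact Nat.cast_ne_zero.mpr i.factorial_ne_zero

/-- A mass `m` only multiplies the series by `e^{mX}`, which does not depend on `(k, η)`. The Cauchy
product therefore reduces to mass `0` for each order at most `i`. -/
theorem tsum_reproMarkLaw_mul_coeff_add (hsub : ∑' k : ℕ, (k : ℝ≥0∞) * p k < 1)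
    (hmom : ∑' k : ℕ, (k : ℝ≥0∞) ^ ℓ * p k < ∞) {i : ℕ} (hi : i ≤ ℓ) {m : ℝ} (hm : 0 ≤ m) :
    ∑' x, reproMarkLaw p q x *
      ENNReal.ofReal (PowerSeries.coeff i (momentSeries (xi p q) (m + (x.2.toNat : ℝ)) x.1)) =
      ENNReal.ofReal (PowerSeries.coeff i (momentSeries (xi p q) m 1)) := by
  have hsplit : ∀ {s : ℝ} {z : ℕ}, 0 ≤ s →
      ENNReal.ofReal (PowerSeries.coeff i (momentSeries (xi p q) (m + s) z)) =
        ∑ jl ∈ Finset.HasAntidiagonal.antidiagonal i,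
          ENNReal.ofReal (PowerSeries.coeff jl.1 (momentSeries (xi p q) m 0)) *
            ENNReal.ofReal (PowerSeries.coeff jl.2 (momentSeries (xi p q) s z)) := by
    intro s z hs
    have hj : ∀ j, 0 ≤ PowerSeries.coeff j (momentSeries (xi p q) m 0) := fun j =>
      coeff_momentSeries_nonneg (xi_nonneg p q) j hm 0
    have hl : ∀ l, 0 ≤ PowerSeries.coeff l (momentSeries (xi p q) s z) := fun l =>
      coeff_momentSeries_nonneg (xi_nonneg p q) l hs z
    have hmul := momentSeries_mul (xi p q) m s 0 z
    rw [zero_add] at hmul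
    rw [← hmul, PowerSeries.coeff_mul,
      ENNReal.ofReal_sum_of_nonneg fun jl _ => mul_nonneg (hj _) (hl _)]
    exact Finset.sum_congr rfl fun jl _ => ENNReal.ofReal_mul (hj _)
  have h1 := hsplit (s := 0) (z := 1) le_rfl
  rw [add_zero] at h1
  rw [h1]
  simp_rw [hsplit (Nat.cast_nonneg _), Finset.mul_sum]
  rw [Summable.tsum_finsetSum fun _ _ => ENNReal.summable]
  refine Finset.sum_congr rfl fun jl hjl => ?_
  simp_rw [mul_left_comm (reproMarkLaw p q _)]
  rw [ENNReal.tsum_mul_left, tsum_reproMarkLaw_mul_coeff hsub hmom]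
  have := Finset.HasAntidiagonal.mem_antidiagonal.mp hjl
  omega

/-- The factor `i! / ξ_i` cancels in the quotient. Type `0` obeys the same formula because all
coefficients of order `0` are `1`, so it needs no separate treatment later. -/
theorem typedLaw_eq {i : ℕ} (hi : 0 < xi p q i) (m : ℝ) (k : ℕ) (η : Bool) :
    typedLaw p q i m k η = (reproMarkLaw p q (k, η)).toReal *
      (PowerSeries.coeff i (momentSeries (xi p q) (m + η.toNat) k) /
        PowerSeries.coeff i (momentSeries (xi p q) m 1)) := by
  rw [typedLaw]
  split_ifs with h
  · subst h
    have h0 : ∀ s z, PowerSeries.coeff 0 (momentSeries (xi p q) s z) = 1 := by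
      intro s z
      have := weight_mul_xi (xi_zero p q ▸ one_ne_zero) s z
      rwa [weight_zero_left (xi_zero p q), xi_zero, Nat.factorial_zero, Nat.cast_one, one_mul,
        one_mul, eq_comm] at this
    rw [h0, h0, div_one, mul_one]
  · have hne : (i ! : ℝ) / xi p q i ≠ 0 :=
      div_ne_zero (Nat.cast_ne_zero.mpr i.factorial_ne_zero) hi.ne'
    have hc : ∀ c, (i ! : ℝ) * c / xi p q i = (i ! : ℝ) / xi p q i * c := fun c =>
      mul_div_right_comm _ _ _
    rw [weight_eq, weight_eq, mul_div_assoc, hc, hc, mul_div_mul_left _ _ hne]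

theorem typedLaw_nonneg {i : ℕ} {m : ℝ} (hm : 0 ≤ m) (k : ℕ) (η : Bool) :
    0 ≤ typedLaw p q i m k η := by
  rw [typedLaw]
  have h := weight_nonneg p q i (add_nonneg hm (Nat.cast_nonneg η.toNat)) k
  have h' := weight_nonneg p q i hm 1
  split_ifs <;> positivity

theorem tsum_typedLaw (hsub : ∑' k : ℕ, (k : ℝ≥0∞) * p k < 1)
    (hmom : ∑' k : ℕ, (k : ℝ≥0∞) ^ ℓ * p k < ∞)
    (hq : ∃ k : ℕ, 0 < (p k).toReal * (q k : ℝ)) {i : ℕ} (hi : i ≤ ℓ) {m : ℝ} (hm : 0 ≤ m) :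
    ∑' x : ℕ × Bool, ENNReal.ofReal (typedLaw p q i m x.1 x.2) = 1 := by
  have hpos := xi_pos hsub hmom hq hi
  have hc : 0 < PowerSeries.coeff i (momentSeries (xi p q) m 1) :=
    coeff_momentSeries_pos (xi_nonneg p q) (xi_zero p q ▸ one_pos) hpos hm one_ne_zero
  simp_rw [typedLaw_eq hpos, ENNReal.ofReal_mul ENNReal.toReal_nonneg,
    ENNReal.ofReal_toReal ((reproMarkLaw p q).apply_ne_top _), ENNReal.ofReal_div_of_pos hc,
    div_eq_mul_inv, ← mul_assoc]
  rw [ENNReal.tsum_mul_right, tsum_reproMarkLaw_mul_coeff_add hsub hmom hi hm,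
    ENNReal.mul_inv_cancel (ENNReal.ofReal_pos.mpr hc).ne' ENNReal.ofReal_ne_top]

variable {t : MarkedTree} {n : ℕ}

theorem le_of_sum_eq {s : List ℕ → ℕ} (hs : ∑ u ∈ t.level n, s u = ℓ) {u : List ℕ}
    (hu : u ∈ t.level n) : s u ≤ ℓ :=
  hs ▸ Finset.single_le_sum (fun _ _ => Nat.zero_le _) hu

theorem coeff_numMarks_pos (hpos : ∀ i ≤ ℓ, 0 < xi p q i) (hn : (t.level n).Nonempty) :
    0 < PowerSeries.coeff ℓ (momentSeries (xi p q) (t.numMarks n : ℝ) (t.levelSize n)) :=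
  coeff_momentSeries_pos (xi_nonneg p q) (xi_zero p q ▸ one_pos) (hpos ℓ le_rfl)
    (Nat.cast_nonneg _) (Finset.card_pos.mpr hn).ne'

theorem typeProb_eq (hpos : ∀ i ≤ ℓ, 0 < xi p q i) {s : List ℕ → ℕ}
    (hs : ∑ u ∈ t.level n, s u = ℓ) :
    typeProb p q ℓ t n s =
      (∏ u ∈ t.level n, PowerSeries.coeff (s u) (momentSeries (xi p q) (t.mass u) 1)) /
        PowerSeries.coeff ℓ (momentSeries (xi p q) (t.numMarks n) (t.levelSize n)) := by
  have h1 : ∏ u ∈ t.level n, weight p q (s u) (t.mass u) 1 * xi p q (s u) =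
      (∏ u ∈ t.level n, ((s u)! : ℝ)) *
        ∏ u ∈ t.level n, PowerSeries.coeff (s u) (momentSeries (xi p q) (t.mass u) 1) := by
    rw [← Finset.prod_mul_distrib]
    exact Finset.prod_congr rfl fun u hu => weight_mul_xi (hpos _ (le_of_sum_eq hs hu)).ne' _ _
  have h2 : (∏ u ∈ t.level n, ((s u)! : ℝ)) ≠ 0 :=
    Finset.prod_ne_zero_iff.mpr fun u _ => Nat.cast_ne_zero.mpr (Nat.factorial_ne_zero _)
  have h3 : (ℓ ! : ℝ) ≠ 0 := Nat.cast_ne_zero.mpr ℓ.factorial_ne_zero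
  rw [typeProb, h1, mul_comm (xi p q ℓ), weight_mul_xi (hpos ℓ le_rfl).ne',
    div_mul_div_comm, mul_left_comm (∏ u ∈ t.level n, ((s u)! : ℝ)) (ℓ ! : ℝ),
    mul_div_mul_left _ _ h3,
    mul_div_mul_left _ _ h2]

theorem typeProb_nonneg (hpos : ∀ i ≤ ℓ, 0 < xi p q i) {s : List ℕ → ℕ}
    (hs : ∑ u ∈ t.level n, s u = ℓ) : 0 ≤ typeProb p q ℓ t n s := by
  rw [typeProb_eq hpos hs]
  exact div_nonneg (Finset.prod_nonneg fun u _ =>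
    coeff_momentSeries_nonneg (xi_nonneg p q) _ (t.mass_nonneg u) _)
    (coeff_momentSeries_nonneg (xi_nonneg p q) _ (Nat.cast_nonneg _) _)

/-- Summing over types of total `ℓ` computes the coefficient of order `ℓ` of the product of the
`G(m_u, 1)`, which is `G(M_n, Z_n)` by conservation of mass. -/
theorem sum_typeProb (hpos : ∀ i ≤ ℓ, 0 < xi p q i) (hn : (t.level n).Nonempty) :
    ∑ s ∈ (t.level n).piAntidiag ℓ, typeProb p q ℓ t n s = 1 := by
  rw [Finset.sum_congr rfl fun s hs => typeProb_eq hpos (Finset.mem_piAntidiag.mp hs).1,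
    ← Finset.sum_div, coeff_momentSeries_prod (xi p q) (t.level n) t.mass fun _ => 1,
    MarkedTree.sum_mass_level t n hn, ← Finset.card_eq_sum_ones]
  exact div_self (coeff_numMarks_pos hpos hn).ne'

theorem sum_mass_add_eta (hn : (t.level n).Nonempty) :
    ∑ u ∈ t.level n, (t.mass u + ((t.mark u).toNat : ℝ)) = t.numMarks (n + 1) := by
  rw [Finset.sum_add_distrib, MarkedTree.sum_mass_level t n hn, MarkedTree.numMarks_succ]
  push_cast
  rfl

/-- The heart of the proof. The denominators of the laws `p_{t_u}` are the numerators of `γ`, and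
the denominator of `γ` cancels against `f_ℓ(M_n, Z_n)`. The sum over types is again a convolution,
now of the series `G(m_u + η_u, k_u)`. -/
theorem sum_typeProb_mul_typedLaw (hpos : ∀ i ≤ ℓ, 0 < xi p q i) (hn : (t.level n).Nonempty) :
    ∑ s ∈ (t.level n).piAntidiag ℓ,
      weight p q ℓ (t.numMarks n) (t.levelSize n) * typeProb p q ℓ t n s *
        ∏ u ∈ t.level n, typedLaw p q (s u) (t.mass u) (t.numChildren u) (t.mark u) =
      (∏ u ∈ t.level n, (reproMarkLaw p q (t.numChildren u, t.mark u)).toReal) *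
        weight p q ℓ (t.numMarks (n + 1)) (t.levelSize (n + 1)) := by
  have hterm : ∀ s ∈ (t.level n).piAntidiag ℓ,
      weight p q ℓ (t.numMarks n) (t.levelSize n) * typeProb p q ℓ t n s *
        ∏ u ∈ t.level n, typedLaw p q (s u) (t.mass u) (t.numChildren u) (t.mark u) =
      ((ℓ ! : ℝ) / xi p q ℓ *
        ∏ u ∈ t.level n, (reproMarkLaw p q (t.numChildren u, t.mark u)).toReal) *
        ∏ u ∈ t.level n, PowerSeries.coeff (s u)
          (momentSeries (xi p q) (t.mass u + (t.mark u).toNat) (t.numChildren u)) := by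
    intro s hs
    have hs := (Finset.mem_piAntidiag.mp hs).1
    have h1 : ∏ u ∈ t.level n, typedLaw p q (s u) (t.mass u) (t.numChildren u) (t.mark u) =
        (∏ u ∈ t.level n, (reproMarkLaw p q (t.numChildren u, t.mark u)).toReal) *
          ((∏ u ∈ t.level n, PowerSeries.coeff (s u)
            (momentSeries (xi p q) (t.mass u + (t.mark u).toNat) (t.numChildren u))) /
          ∏ u ∈ t.level n, PowerSeries.coeff (s u) (momentSeries (xi p q) (t.mass u) 1)) := by
      rw [← Finset.prod_div_distrib, ← Finset.prod_mul_distrib]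
      exact Finset.prod_congr rfl fun u hu => typedLaw_eq (hpos _ (le_of_sum_eq hs hu)) _ _ _
    have h2 : (∏ u ∈ t.level n,
        PowerSeries.coeff (s u) (momentSeries (xi p q) (t.mass u) 1)) ≠ 0 :=
      Finset.prod_ne_zero_iff.mpr fun u hu => (coeff_momentSeries_pos (xi_nonneg p q)
        (xi_zero p q ▸ one_pos) (hpos _ (le_of_sum_eq hs hu)) (t.mass_nonneg u) one_ne_zero).ne'
    have h3 := (coeff_numMarks_pos hpos hn).ne'
    rw [h1, typeProb_eq hpos hs, weight_eq]
    field_simp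
  rw [Finset.sum_congr rfl hterm, ← Finset.mul_sum,
    coeff_momentSeries_prod (xi p q) (t.level n) (fun u => t.mass u + (t.mark u).toNat)
      t.numChildren, sum_mass_add_eta hn, ← MarkedTree.levelSize_succ, weight_eq]
  ring

end TypedLaw

/-! ### Cylinders and uniqueness of the transformed measure -/

namespace MarkedTree

/-- The treeCylinder of the trees that coincide with `t` up to generation `n`. -/
def treeCylinder (n : ℕ) (t : MarkedTree) : Set MarkedTree :=
  {t' | t'.restrict n = t.restrict n}

theorem mem_treeCylinder {n : ℕ} {t t' : MarkedTree} :
    t' ∈ treeCylinder n t ↔ t'.restrict n = t.restrict n := Iff.rfl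

theorem measurableSet_filtration_cylinder (n : ℕ) (t : MarkedTree) :
    MeasurableSet[filtration n] (treeCylinder n t) :=
  ⟨{t.restrict n}, measurableSet_singleton _, rfl⟩

theorem filtration_le (n : ℕ) : filtration n ≤ instMeasurableSpace :=
  (measurable_restrict n).comap_le

theorem measurableSet_cylinder (n : ℕ) (t : MarkedTree) : MeasurableSet (treeCylinder n t) :=
  filtration_le n _ (measurableSet_filtration_cylinder n t)

theorem cylinder_zero (t : MarkedTree) : treeCylinder 0 t = Set.univ :=
  Set.eq_univ_of_forall fun t' => restrict_zero_eq t' t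

theorem restrict_restrict_of_le (t : MarkedTree) {m n : ℕ} (h : m ≤ n) :
    (t.restrict n).restrict m = t.restrict m :=
  restrict_eq_of_le h (restrict_restrict t n)

theorem filtration_mono {m n : ℕ} (h : m ≤ n) : filtration m ≤ filtration n := by
  rintro _ ⟨B, hB, rfl⟩
  refine ⟨restrict m ⁻¹' B, measurable_restrict m hB, ?_⟩
  ext t
  simp [restrict_restrict_of_le t h]

/-- Every set of `ℱ_n` is a countable disjoint union of cylinders, so no finiteness of the measures
is needed. -/
theorem measure_eq_of_cylinder {μ ν : Measure MarkedTree} {n : ℕ}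
    (h : ∀ t, μ (treeCylinder n t) = ν (treeCylinder n t)) {A : Set MarkedTree}
    (hA : MeasurableSet[filtration n] A) : μ A = ν A := by
  obtain ⟨B, -, rfl⟩ := hA
  have hU : restrict n ⁻¹' B = ⋃ c ∈ Set.range (restrict n) ∩ B, restrict n ⁻¹' {c} := by
    ext t
    simp
  have hc : (Set.range (restrict n) ∩ B).Countable :=
    (countable_range_restrict n).mono Set.inter_subset_left
  have hd : (Set.range (restrict n) ∩ B).PairwiseDisjoint fun c => restrict n ⁻¹' {c} :=
    fun c _ c' _ hcc => Disjoint.preimage _ (by simpa using hcc)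
  have hm : ∀ c ∈ Set.range (restrict n) ∩ B, MeasurableSet (restrict n ⁻¹' {c}) :=
    fun c _ => measurable_restrict n (measurableSet_singleton c)
  rw [hU, measure_biUnion hc hd hm, measure_biUnion hc hd hm]
  refine tsum_congr fun ⟨c, ⟨t, ht⟩, _⟩ => ?_
  subst ht
  exact h t

theorem generateFrom_filtration :
    instMeasurableSpace =
      MeasurableSpace.generateFrom {A | ∃ n, MeasurableSet[filtration n] A} := by
  refine le_antisymm (MeasurableSpace.generateFrom_le ?_) (MeasurableSpace.generateFrom_le ?_)
  · rintro _ (⟨u, rfl⟩ | ⟨u, rfl⟩)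
    · refine MeasurableSpace.measurableSet_generateFrom
        ⟨u.length + 1, _, measurableSet_mem u, ?_⟩
      ext t
      simp [restrict]
    · refine MeasurableSpace.measurableSet_generateFrom
        ⟨u.length + 1, _, measurableSet_mark u, ?_⟩
      ext t
      simp [restrict]
  · rintro A ⟨n, hA⟩
    exact filtration_le n A hA

theorem isPiSystem_filtration : IsPiSystem {A | ∃ n, MeasurableSet[filtration n] A} := by
  rintro A ⟨m, hA⟩ B ⟨n, hB⟩ -
  exact ⟨max m n, MeasurableSet.inter (filtration_mono (le_max_left m n) _ hA)
    (filtration_mono (le_max_right m n) _ hB)⟩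

/-- Generation by generation, agreement so far guarantees that the vertices of `t` are vertices of
the built tree, so the values of the family there are its offspring numbers and marks. A cylinder
becomes a finite rectangle of families. -/
theorem restrict_ofFamily_eq_iff {x : List ℕ → ℕ × Bool} {t : MarkedTree} {n : ℕ} :
    (ofFamily x).restrict n = t.restrict n ↔
      ∀ u ∈ t.past n, x u = (t.numChildren u, t.mark u) := by
  induction n with
  | zero => simp [past_zero, restrict_zero_eq _ t]
  | succ n ih =>
    rw [restrict_succ_eq_iff, past_succ]
    rw [Finset.forall_mem_union, ← ih]
    refine and_congr_right fun h => forall₂_congr fun u hu => ?_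
    have hmem : u ∈ (ofFamily x).nodes := by
      have := mem_level.mp hu
      exact (mem_of_restrict_eq h this.2.le).mpr this.1
    rw [numChildren_ofFamily hmem, mark_ofFamily hmem, Prod.ext_iff]

theorem markedGaltonWatson_cylinder (p : PMF ℕ) (q : ℕ → unitInterval) (n : ℕ) (t : MarkedTree) :
    markedGaltonWatson p q (treeCylinder n t) =
      ∏ u ∈ t.past n, reproMarkLaw p q (t.numChildren u, t.mark u) := by
  have h : ofFamily ⁻¹' treeCylinder n t =
      Set.pi (t.past n) fun u => {(t.numChildren u, t.mark u)} := by
    ext x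
    simp only [Set.mem_preimage, mem_treeCylinder, restrict_ofFamily_eq_iff, Set.mem_pi,
      Finset.mem_coe, Set.mem_singleton_iff]
  rw [markedGaltonWatson, Measure.map_apply measurable_ofFamily (measurableSet_cylinder n t), h,
    Measure.infinitePi_pi _ fun _ _ => measurableSet_singleton _]
  exact Finset.prod_congr rfl fun u _ =>
    PMF.toMeasure_apply_singleton _ _ (measurableSet_singleton _)

theorem markedGaltonWatson_cylinder_succ (p : PMF ℕ) (q : ℕ → unitInterval) (n : ℕ)
    (t : MarkedTree) :
    markedGaltonWatson p q (treeCylinder (n + 1) t) = markedGaltonWatson p q (treeCylinder n t) *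
      ∏ u ∈ t.level n, reproMarkLaw p q (t.numChildren u, t.mark u) := by
  rw [markedGaltonWatson_cylinder, markedGaltonWatson_cylinder, past_succ,
    Finset.prod_union (disjoint_past_level t n)]

end MarkedTree

open MarkedTree

/-- The density `f_ℓ(M_n, Z_n)` is constant on each cylinder of order `n`. -/
theorem isGirsanovTransform_iff {p : PMF ℕ} {q : ℕ → unitInterval} {ℓ : ℕ}
    {Q : Measure MarkedTree} : IsGirsanovTransform p q ℓ Q ↔ ∀ n t, Q (treeCylinder n t) =
      ENNReal.ofReal (weight p q ℓ (t.numMarks n) (t.levelSize n)) *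
        markedGaltonWatson p q (treeCylinder n t) := by
  have hconst : ∀ n t, ∫⁻ t' in treeCylinder n t,
      ENNReal.ofReal (weight p q ℓ (t'.numMarks n) (t'.levelSize n)) ∂(markedGaltonWatson p q) =
      ENNReal.ofReal (weight p q ℓ (t.numMarks n) (t.levelSize n)) *
        markedGaltonWatson p q (treeCylinder n t) := by
    intro n t
    rw [← setLIntegral_const]
    refine setLIntegral_congr_fun (measurableSet_cylinder n t) fun t' ht' => ?_
    have ht' := mem_treeCylinder.mp ht'
    simp only [numMarks_of_restrict_eq ht', levelSize, level_of_restrict_eq le_rfl ht']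
  refine ⟨fun h n t => ?_, fun h n A hA => ?_⟩
  · rw [h n _ (measurableSet_filtration_cylinder n t), hconst]
  · rw [← withDensity_apply _ (filtration_le n A hA)]
    refine measure_eq_of_cylinder (n := n) (fun t => ?_) hA
    rw [withDensity_apply _ (measurableSet_cylinder n t), h, hconst]

theorem IsGirsanovTransform.eq {p : PMF ℕ} {q : ℕ → unitInterval} {ℓ : ℕ}
    {Q Q' : Measure MarkedTree} [IsFiniteMeasure Q] (h : IsGirsanovTransform p q ℓ Q)
    (h' : IsGirsanovTransform p q ℓ Q') : Q = Q' := by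
  have hA : ∀ n A, MeasurableSet[filtration n] A → Q A = Q' A := fun n A hA => by
    rw [h n A hA, h' n A hA]
  exact ext_of_generate_finite _ generateFrom_filtration isPiSystem_filtration
    (fun A ⟨n, hn⟩ => hA n A hn) (hA 0 _ MeasurableSet.univ)

/-! ### The law of an arbitrary weighted tree -/

theorem typeProb_congr {p : PMF ℕ} {q : ℕ → unitInterval} {ℓ : ℕ} {t t' : MarkedTree} {n : ℕ}
    (h : t.restrict n = t'.restrict n) {s s' : List ℕ → ℕ} (hs : ∀ u ∈ t.level n, s u = s' u) :
    typeProb p q ℓ t n s = typeProb p q ℓ t' n s' := by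
  have h1 : ∏ u ∈ t.level n, ((s u)! : ℝ) = ∏ u ∈ t.level n, ((s' u)! : ℝ) :=
    Finset.prod_congr rfl fun u hu => by rw [hs u hu]
  have h2 : ∏ u ∈ t.level n, weight p q (s u) (t.mass u) 1 * xi p q (s u) =
      ∏ u ∈ t.level n, weight p q (s' u) (t'.mass u) 1 * xi p q (s' u) :=
    Finset.prod_congr rfl fun u hu => by
      rw [hs u hu, mass_of_restrict_eq h (mem_level.mp hu).2.le]
  simp only [typeProb, levelSize]
  rw [h1, h2, numMarks_of_restrict_eq h, level_of_restrict_eq le_rfl h]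

/-- Sums out the types on `V`. The defining formulas of a weighted tree prescribe all past types,
whereas their factors depend only on the current types, so the constant `c` comes out of the
countable sum. -/
theorem measure_eq_mul_of_forall_eqOn {Ω : Type*} [MeasurableSpace Ω] {P : Measure Ω}
    {T : Ω → List ℕ → ℕ} (hT : ∀ u, Measurable fun ω => T ω u) (V : Finset (List ℕ))
    {E E' : Set Ω} (hE : MeasurableSet E) (hE' : MeasurableSet E') {c : ℝ≥0∞}
    (h : ∀ s : List ℕ → ℕ,
      P (E ∩ {ω | ∀ u ∈ V, T ω u = s u}) = P (E' ∩ {ω | ∀ u ∈ V, T ω u = s u}) * c) :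
    P E = P E' * c := by
  classical
  let ext : (V → ℕ) → List ℕ → ℕ := fun g u => if hu : u ∈ V then g ⟨u, hu⟩ else 0
  have key : ∀ F : Set Ω, MeasurableSet F →
      P F = ∑' g : V → ℕ, P (F ∩ {ω | ∀ u ∈ V, T ω u = ext g u}) := by
    intro F hF
    rw [← measure_iUnion]
    · congr 1
      ext ω
      simp only [Set.mem_iUnion, Set.mem_inter_iff, Set.mem_ofPred_eq, exists_and_left]
      refine ⟨fun hω => ⟨hω, fun u => T ω u, fun u hu => ?_⟩, fun hω => hω.1⟩
      simp [ext, hu]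
    · intro g g' hg
      rw [Function.onFun, Set.disjoint_left]
      rintro ω ⟨-, h1⟩ ⟨-, h2⟩
      refine hg (funext fun u => ?_)
      have h3 := (h1 u u.2).symm.trans (h2 u u.2)
      simpa [ext] using h3
    · intro g
      refine hF.inter ?_
      have : {ω | ∀ u ∈ V, T ω u = ext g u} = ⋂ u ∈ V, {ω | T ω u = ext g u} := by
        ext ω; simp
      rw [this]
      exact Finset.measurableSet_biInter V fun u _ => hT u (measurableSet_singleton _)
  rw [key E hE, key E' hE', ← ENNReal.tsum_mul_right]
  exact tsum_congr fun g => h _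

namespace IsWeightedTree

variable {p : PMF ℕ} {q : ℕ → unitInterval} {ℓ : ℕ} {Ω : Type*} [MeasurableSpace Ω]
  {P : Measure Ω} {τ : Ω → MarkedTree} {T : Ω → List ℕ → ℕ}

theorem measurableSet_cylinder_inter (W : IsWeightedTree p q ℓ P τ T) (n : ℕ) (t : MarkedTree)
    (V : Finset (List ℕ)) (s : List ℕ → ℕ) :
    MeasurableSet {ω | τ ω ∈ treeCylinder n t ∧ ∀ u ∈ V, T ω u = s u} := by
  have : {ω | τ ω ∈ treeCylinder n t ∧ ∀ u ∈ V, T ω u = s u} =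
      τ ⁻¹' treeCylinder n t ∩ ⋂ u ∈ V, {ω | T ω u = s u} := by
    ext ω; simp
  rw [this]
  refine (W.measurable_tree (measurableSet_cylinder n t)).inter ?_
  exact Finset.measurableSet_biInter V fun u _ =>
    W.measurable_type u (measurableSet_singleton _)

theorem measure_reproduction (W : IsWeightedTree p q ℓ P τ T) (n : ℕ) (t : MarkedTree)
    (s : List ℕ → ℕ) :
    P {ω | τ ω ∈ treeCylinder (n + 1) t ∧ ∀ u ∈ t.level n, T ω u = s u} =
      P {ω | τ ω ∈ treeCylinder n t ∧ ∀ u ∈ t.level n, T ω u = s u} *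
        ∏ u ∈ t.level n,
          ENNReal.ofReal (typedLaw p q (s u) (t.mass u) (t.numChildren u) (t.mark u)) := by
  classical
  refine measure_eq_mul_of_forall_eqOn W.measurable_type (t.past n)
    (W.measurableSet_cylinder_inter _ t _ s) (W.measurableSet_cylinder_inter _ t _ s) fun s' => ?_
  -- The past types `s'` to be summed out and the current types `s` are merged into one function;
  -- the product only reads it at length `n`.
  have h := W.reproduction n t fun u => if u.length < n then s' u else s u
  have hev : ∀ m, {ω | τ ω ∈ treeCylinder m t ∧ ∀ u ∈ t.level n, T ω u = s u} ∩
      {ω | ∀ u ∈ t.past n, T ω u = s' u} =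
      {ω | (τ ω).restrict m = t.restrict m ∧
        ∀ u ∈ t.nodes, u.length ≤ n → T ω u = if u.length < n then s' u else s u} := by
    intro m
    ext ω
    simp only [Set.mem_inter_iff, Set.mem_ofPred_eq, mem_treeCylinder, mem_level, mem_past, and_assoc]
    refine and_congr_right fun _ => ⟨fun hω u hu hl => ?_, fun hω => ⟨fun u hu => ?_,
      fun u hu => ?_⟩⟩
    · split_ifs with hlt
      · exact hω.2 u ⟨hu, hlt⟩
      · exact hω.1 u ⟨hu, by omega⟩
    · simpa [hu.2] using hω u hu.1 hu.2.le
    · simpa [hu.2] using hω u hu.1 hu.2.le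
  rw [hev, hev, h]
  congr 1
  refine Finset.prod_congr rfl fun u hu => ?_
  simp [(mem_level.mp hu).2]

theorem measure_types [IsProbabilityMeasure P] (hpos : ∀ i ≤ ℓ, 0 < xi p q i)
    (W : IsWeightedTree p q ℓ P τ T) (n : ℕ) (t : MarkedTree) (hn : (t.level n).Nonempty)
    (s : List ℕ → ℕ) (hs : ∑ u ∈ t.level n, s u = ℓ) :
    P {ω | τ ω ∈ treeCylinder n t ∧ ∀ u ∈ t.level n, T ω u = s u} =
      P {ω | τ ω ∈ treeCylinder n t} * ENNReal.ofReal (typeProb p q ℓ t n s) := by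
  classical
  rcases n with _ | n
  -- Generation `0` is not covered by the field `types`. There the type is almost surely `ℓ` and the
  -- formula for `γ` gives `1`.
  · rw [level_zero, Finset.sum_singleton] at hs
    have h1 : typeProb p q ℓ t 0 s = 1 := by
      rw [typeProb_eq hpos (by simpa [level_zero] using hs)]
      have hc := coeff_numMarks_pos hpos hn
      simp only [level_zero, levelSize, numMarks, Finset.prod_singleton, hs,
        Finset.card_singleton, Finset.range_zero, Finset.sum_empty, Nat.cast_zero] at hc ⊢
      exact div_self hc.ne'
    rw [h1, ENNReal.ofReal_one, mul_one]
    refine measure_congr ?_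
    filter_upwards [W.root_type] with ω hω
    refine propext ⟨fun h => h.1, fun h => ⟨h, fun u hu => ?_⟩⟩
    rw [level_zero, Finset.mem_singleton] at hu
    rw [hu, hω, hs]
  · refine measure_eq_mul_of_forall_eqOn W.measurable_type (t.past (n + 1))
      (W.measurableSet_cylinder_inter _ t _ s)
      (W.measurable_tree (measurableSet_cylinder (n + 1) t)) fun s' => ?_
    set s'' : List ℕ → ℕ := fun u => if u.length ≤ n then s' u else s u with hs''
    have hlev : ∀ u ∈ t.level (n + 1), s'' u = s u := fun u hu => by
      simp [hs'', (mem_level.mp hu).2]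
    have h := W.types n t s'' hn ((Finset.sum_congr rfl hlev).trans hs)
    have hγ := typeProb_congr (p := p) (q := q) (ℓ := ℓ) (t := t) rfl hlev
    rw [hγ] at h
    convert h using 2
    · ext ω
      simp only [Set.mem_inter_iff, Set.mem_ofPred_eq, mem_treeCylinder, mem_level, mem_past,
        and_assoc]
      refine and_congr_right fun _ => ⟨fun hω u hu hl => ?_, fun hω => ⟨fun u hu => ?_,
        fun u hu => ?_⟩⟩
      · simp only [hs'']
        split_ifs with hlt
        · exact hω.2 u ⟨hu, by omega⟩
        · exact hω.1 u ⟨hu, by omega⟩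
      · simpa [hs'', hu.2] using hω u hu.1 hu.2.le
      · have := hω u hu.1 hu.2.le
        simpa only [hs'', Nat.lt_succ_iff.mp hu.2, if_true] using this
    · congr 1
      ext ω
      simp only [Set.mem_inter_iff, Set.mem_ofPred_eq, mem_past]
      refine and_congr_right fun _ => ⟨fun hω u hu hl => ?_, fun hω u hu => ?_⟩
      · simp only [hs'', hl, if_true]
        exact hω u ⟨hu, by omega⟩
      · have hl : u.length ≤ n := by omega
        simpa only [hs'', hl, if_true] using hω u hu.1 hl

/-- Almost surely the types of generation `m` have sum `ℓ`. Functions in `piAntidiag` vanish off the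
generation, so each type assignment is counted once. -/
theorem measure_cylinder_eq_sum (W : IsWeightedTree p q ℓ P τ T) {m n : ℕ} (hmn : m ≤ n)
    (t : MarkedTree) (hm : (t.level m).Nonempty) :
    P {ω | τ ω ∈ treeCylinder n t} = ∑ s ∈ (t.level m).piAntidiag ℓ,
      P {ω | τ ω ∈ treeCylinder n t ∧ ∀ u ∈ t.level m, T ω u = s u} := by
  classical
  rw [← measure_biUnion_finset]
  · refine measure_congr ?_
    filter_upwards [W.sum_type m] with ω hω
    refine propext ?_
    change _ ↔ ω ∈ ⋃ s ∈ (t.level m).piAntidiag ℓ,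
      {ω | τ ω ∈ treeCylinder n t ∧ ∀ u ∈ t.level m, T ω u = s u}
    simp only [Set.mem_iUnion, Set.mem_ofPred_eq, exists_prop]
    refine ⟨fun h => ⟨fun u => if u ∈ t.level m then T ω u else 0, ?_, h, ?_⟩, fun ⟨_, _, h⟩ => h.1⟩
    · have hl : (τ ω).level m = t.level m := level_of_restrict_eq hmn h
      rw [hl] at hω
      rw [Finset.mem_piAntidiag]
      refine ⟨?_, fun u hu => ?_⟩
      · rw [← hω hm]
        exact Finset.sum_congr rfl fun u hu => if_pos hu
      · by_contra hc
        simp [hc] at hu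
    · intro u hu
      simp [hu]
  · intro s hs s' hs' hne
    rw [Function.onFun, Set.disjoint_left]
    rintro ω ⟨-, h1⟩ ⟨-, h2⟩
    refine hne (funext fun u => ?_)
    by_cases hu : u ∈ t.level m
    · exact (h1 u hu).symm.trans (h2 u hu)
    · have h3 := mt ((Finset.mem_piAntidiag.mp hs).2 u) hu
      have h4 := mt ((Finset.mem_piAntidiag.mp hs').2 u) hu
      simp only [not_not] at h3 h4
      rw [h3, h4]
  · exact fun s _ => W.measurableSet_cylinder_inter _ t _ s

/-- Induction on the generation: split according to the types of generation `n`, apply the type and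
reproduction formulas, and recombine with `sum_typeProb_mul_typedLaw`. -/
theorem measure_cylinder [IsProbabilityMeasure P] (hpos : ∀ i ≤ ℓ, 0 < xi p q i)
    (W : IsWeightedTree p q ℓ P τ T) (n : ℕ) (t : MarkedTree) :
    P {ω | τ ω ∈ treeCylinder n t} =
      ENNReal.ofReal (weight p q ℓ (t.numMarks n) (t.levelSize n)) *
        markedGaltonWatson p q (treeCylinder n t) := by
  induction n with
  | zero =>
    simp [cylinder_zero, numMarks, levelSize, level_zero, weight_zero_one (hpos ℓ le_rfl).ne']
  | succ n ih =>
    rcases Finset.eq_empty_or_nonempty (t.level n) with hn | hn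
    -- After extinction no type is prescribed, so the function `0` is arbitrary; neither `M` nor `Z`
    -- changes any more.
    · have h := W.measure_reproduction n t 0
      simp only [hn, Finset.notMem_empty, false_imp_iff, implies_true, and_true,
        Finset.prod_empty, mul_one] at h
      rw [h, ih, markedGaltonWatson_cylinder_succ, numMarks_succ, levelSize, levelSize,
        level_succ_eq_empty hn, hn]
      simp
    · rw [W.measure_cylinder_eq_sum n.le_succ t hn]
      have hw : 0 ≤ weight p q ℓ (t.numMarks n) (t.levelSize n) :=
        weight_nonneg p q ℓ (Nat.cast_nonneg _) _
      have hterm : ∀ s ∈ (t.level n).piAntidiag ℓ,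
          P {ω | τ ω ∈ treeCylinder (n + 1) t ∧ ∀ u ∈ t.level n, T ω u = s u} =
            markedGaltonWatson p q (treeCylinder n t) * ENNReal.ofReal
              (weight p q ℓ (t.numMarks n) (t.levelSize n) * typeProb p q ℓ t n s *
              ∏ u ∈ t.level n, typedLaw p q (s u) (t.mass u) (t.numChildren u) (t.mark u)) := by
        intro s hs
        have hs := (Finset.mem_piAntidiag.mp hs).1
        rw [W.measure_reproduction, W.measure_types hpos n t hn s hs, ih,
          ← ENNReal.ofReal_prod_of_nonneg fun u _ => typedLaw_nonneg (t.mass_nonneg u) _ _,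
          ENNReal.ofReal_mul (mul_nonneg hw (typeProb_nonneg hpos hs)), ENNReal.ofReal_mul hw]
        ring
      have hnn : ∀ s ∈ (t.level n).piAntidiag ℓ,
          0 ≤ weight p q ℓ (t.numMarks n) (t.levelSize n) * typeProb p q ℓ t n s *
              ∏ u ∈ t.level n, typedLaw p q (s u) (t.mass u) (t.numChildren u) (t.mark u) :=
        fun s hs => mul_nonneg
          (mul_nonneg hw (typeProb_nonneg hpos (Finset.mem_piAntidiag.mp hs).1))
          (Finset.prod_nonneg fun u _ => typedLaw_nonneg (t.mass_nonneg u) _ _)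
      rw [Finset.sum_congr rfl hterm, ← Finset.mul_sum, ← ENNReal.ofReal_sum_of_nonneg hnn,
        sum_typeProb_mul_typedLaw hpos hn,
        ENNReal.ofReal_mul (Finset.prod_nonneg fun _ _ => ENNReal.toReal_nonneg),
        ENNReal.ofReal_prod_of_nonneg fun _ _ => ENNReal.toReal_nonneg,
        markedGaltonWatson_cylinder_succ]
      simp_rw [ENNReal.ofReal_toReal ((reproMarkLaw p q).apply_ne_top _)]
      ring

theorem isGirsanovTransform_map [IsProbabilityMeasure P] (hpos : ∀ i ≤ ℓ, 0 < xi p q i)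
    (W : IsWeightedTree p q ℓ P τ T) : IsGirsanovTransform p q ℓ (P.map τ) := by
  rw [isGirsanovTransform_iff]
  intro n t
  rw [Measure.map_apply W.measurable_tree (measurableSet_cylinder n t), ← W.measure_cylinder hpos]
  rfl

end IsWeightedTree

/-! ### Construction of a weighted tree -/

/-- Reads a draw at a random label. The labels contain whole trees and form an uncountable set, but
those actually used take countably many values. -/
theorem measurable_apply_of_countable {Ω β γ : Type*} [MeasurableSpace Ω] [MeasurableSpace β]
    [MeasurableSingletonClass β] [MeasurableSpace γ] {c : Ω → β} (hc : Measurable c) {S : Set β}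
    (hS : S.Countable) (hcS : ∀ ω, c ω ∈ S) {g : β → Ω → γ} (hg : ∀ b, Measurable (g b)) :
    Measurable fun ω => g (c ω) ω := by
  intro A hA
  have : (fun ω => g (c ω) ω) ⁻¹' A = ⋃ b ∈ S, c ⁻¹' {b} ∩ g b ⁻¹' A := by
    ext ω
    simp [hcS ω]
  rw [this]
  exact MeasurableSet.biUnion hS fun b _ => (hc (measurableSet_singleton b)).inter (hg b hA)

section Laws

variable (p : PMF ℕ) (q : ℕ → unitInterval) (ℓ : ℕ)

open Classical in
/-- The probabilities `p_i(k, η)` of a vertex of type `i` and mass `m` as a probability mass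
function, and a trivial one where they do not sum to `1`. -/
noncomputable def typedPMF (i : ℕ) (m : ℝ) : PMF (ℕ × Bool) :=
  if h : ∑' x : ℕ × Bool, ENNReal.ofReal (typedLaw p q i m x.1 x.2) = 1 then
    ⟨fun x => ENNReal.ofReal (typedLaw p q i m x.1 x.2), h ▸ ENNReal.summable.hasSum⟩
  else PMF.pure (0, false)

open Classical in
/-- The probabilities `γ` of the types of generation `n` of `t` as a probability mass function, and
a trivial one where they do not sum to `1`. -/
noncomputable def typesPMF (n : ℕ) (t : MarkedTree) : PMF (List ℕ → ℕ) :=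
  if h : ∑ s ∈ (t.level n).piAntidiag ℓ, ENNReal.ofReal (typeProb p q ℓ t n s) = 1 then
    PMF.ofFinset (fun s => if s ∈ (t.level n).piAntidiag ℓ then
      ENNReal.ofReal (typeProb p q ℓ t n s) else 0) ((t.level n).piAntidiag ℓ)
      (by rw [← h]; exact Finset.sum_congr rfl fun s hs => if_pos hs) fun s hs => if_neg hs
  else PMF.pure 0

variable {p q ℓ}

theorem typedPMF_apply (hsub : ∑' k : ℕ, (k : ℝ≥0∞) * p k < 1)
    (hmom : ∑' k : ℕ, (k : ℝ≥0∞) ^ ℓ * p k < ∞)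
    (hq : ∃ k : ℕ, 0 < (p k).toReal * (q k : ℝ)) {i : ℕ} (hi : i ≤ ℓ) {m : ℝ} (hm : 0 ≤ m)
    (k : ℕ) (η : Bool) :
    typedPMF p q i m (k, η) = ENNReal.ofReal (typedLaw p q i m k η) := by
  have h : typedPMF p q i m = ⟨fun x => ENNReal.ofReal (typedLaw p q i m x.1 x.2),
      tsum_typedLaw hsub hmom hq hi hm ▸ ENNReal.summable.hasSum⟩ :=
    dif_pos (tsum_typedLaw hsub hmom hq hi hm)
  rw [h]
  rfl

open Classical in
theorem typesPMF_apply (hpos : ∀ i ≤ ℓ, 0 < xi p q i) {n : ℕ} {t : MarkedTree}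
    (hn : (t.level n).Nonempty) (s : List ℕ → ℕ) :
    typesPMF p q ℓ n t s = if s ∈ (t.level n).piAntidiag ℓ then
      ENNReal.ofReal (typeProb p q ℓ t n s) else 0 := by
  have h : ∑ s ∈ (t.level n).piAntidiag ℓ, ENNReal.ofReal (typeProb p q ℓ t n s) = 1 := by
    rw [← ENNReal.ofReal_sum_of_nonneg fun s hs =>
      typeProb_nonneg hpos (Finset.mem_piAntidiag.mp hs).1, sum_typeProb hpos hn,
      ENNReal.ofReal_one]
  rw [typesPMF, dif_pos h, PMF.ofFinset_apply]

theorem measurableSet_eqOn_finset (V : Finset (List ℕ)) (s : List ℕ → ℕ) :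
    MeasurableSet {s' : List ℕ → ℕ | ∀ u ∈ V, s' u = s u} := by
  have : {s' : List ℕ → ℕ | ∀ u ∈ V, s' u = s u} = ⋂ u ∈ V, {s' | s' u = s u} := by
    ext; simp
  rw [this]
  exact Finset.measurableSet_biInter V fun u _ =>
    measurableSet_eq_fun (measurable_pi_apply u) measurable_const

theorem typesPMF_toMeasure_eqOn (hpos : ∀ i ≤ ℓ, 0 < xi p q i) {n : ℕ} {t : MarkedTree}
    (hn : (t.level n).Nonempty) (s : List ℕ → ℕ) :
    (typesPMF p q ℓ n t).toMeasure {s' | ∀ u ∈ t.level n, s' u = s u} =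
      if ∑ u ∈ t.level n, s u = ℓ then ENNReal.ofReal (typeProb p q ℓ t n s) else 0 := by
  classical
  -- The only possible atom in the event: a charged function vanishes off generation `n` and is
  -- prescribed on it.
  let s₀ : List ℕ → ℕ := fun u => if u ∈ t.level n then s u else 0
  have hs₀ : ∀ u ∈ t.level n, s₀ u = s u := fun u hu => if_pos hu
  have hmem : s₀ ∈ (t.level n).piAntidiag ℓ ↔ ∑ u ∈ t.level n, s u = ℓ := by
    rw [Finset.mem_piAntidiag, Finset.sum_congr rfl hs₀]
    refine and_iff_left fun u hu => ?_
    by_contra hc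
    exact hu (if_neg hc)
  rw [PMF.toMeasure_apply _ (measurableSet_eqOn_finset _ _), tsum_eq_single s₀]
  · rw [Set.indicator_of_mem (by exact hs₀), typesPMF_apply hpos hn]
    simp only [hmem]
    rw [typeProb_congr rfl hs₀]
  · intro s' hs'
    rw [Set.indicator_apply_eq_zero]
    intro h
    rw [typesPMF_apply hpos hn, if_neg]
    intro hc
    refine hs' (funext fun u => ?_)
    by_cases hu : u ∈ t.level n
    · rw [h u hu, hs₀ u hu]
    · have := mt ((Finset.mem_piAntidiag.mp hc).2 u) hu
      simp only [not_not] at this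
      simp [s₀, hu, this]

theorem ae_typesPMF_sum_eq (hpos : ∀ i ≤ ℓ, 0 < xi p q i) {n : ℕ} {t : MarkedTree}
    (hn : (t.level n).Nonempty) :
    ∀ᵐ s ∂(typesPMF p q ℓ n t).toMeasure, ∑ u ∈ t.level n, s u = ℓ := by
  have hm : Measurable fun s : List ℕ → ℕ => ∑ u ∈ t.level n, s u :=
    Finset.measurable_fun_sum _ fun u _ => measurable_pi_apply u
  have hms : MeasurableSet {s : List ℕ → ℕ | ¬∑ u ∈ t.level n, s u = ℓ} :=
    (hm (measurableSet_singleton ℓ)).compl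
  rw [ae_iff, PMF.toMeasure_apply_eq_zero_iff _ hms, Set.disjoint_left]
  intro s hs hc
  rw [PMF.mem_support_iff, typesPMF_apply hpos hn] at hs
  refine hc ?_
  by_contra h
  exact hs (if_neg fun h' => h (Finset.mem_piAntidiag.mp h').1)

end Laws

/-- The sample space of the construction of a weighted tree: the offspring and mark of a vertex for
every possible type and past, and the types of a generation for every possible past. -/
abbrev WeightedTreeSpace : Type :=
  (List ℕ × ℕ × MarkedTree → ℕ × Bool) × (ℕ × MarkedTree → List ℕ → ℕ)

namespace WeightedTreeSpace

/-- The offspring and marks of the first `n` generations. -/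
noncomputable def familyAt (ω : WeightedTreeSpace) : ℕ → List ℕ → ℕ × Bool
  | 0, _ => (0, false)
  | n + 1, u =>
    if u.length = n then
      ω.1 (u, ω.2 (n, (ofFamily (familyAt ω n)).restrict n) u,
        (ofFamily (familyAt ω n)).restrict n)
    else familyAt ω n u

/-- The offspring and marks of all vertices. -/
noncomputable def family (ω : WeightedTreeSpace) (u : List ℕ) : ℕ × Bool :=
  familyAt ω (u.length + 1) u

/-- The weighted tree. -/
noncomputable def tree (ω : WeightedTreeSpace) : MarkedTree := ofFamily (family ω)

/-- The types of the vertices of the weighted tree. -/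
noncomputable def type (ω : WeightedTreeSpace) (u : List ℕ) : ℕ :=
  ω.2 (u.length, (tree ω).restrict u.length) u

theorem familyAt_eq (ω : WeightedTreeSpace) {n : ℕ} {u : List ℕ} (hu : u.length < n) :
    familyAt ω n u = family ω u := by
  induction n with
  | zero => omega
  | succ n ih =>
    rcases Nat.lt_succ_iff_lt_or_eq.mp hu with h | h
    · rw [← ih h, familyAt, if_neg h.ne]
    · rw [family, h]

/-- The restriction only reads the family at lengths below `n`, so the default values of `familyAt`
at unbuilt vertices are never seen. -/
theorem restrict_tree (ω : WeightedTreeSpace) (n : ℕ) :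
    (tree ω).restrict n = (ofFamily (familyAt ω n)).restrict n := by
  rw [tree, restrict_ofFamily_eq_iff]
  intro u hu
  obtain ⟨hu, hl⟩ := mem_past.mp hu
  rw [numChildren_ofFamily hu, mark_ofFamily hu, familyAt_eq ω hl]

/-- Each vertex uses the draw labelled by itself, its own type and the tree before it. This
consistency equation is all that later arguments use of the recursive definition. -/
theorem family_eq (ω : WeightedTreeSpace) (u : List ℕ) :
    family ω u = ω.1 (u, type ω u, (tree ω).restrict u.length) := by
  rw [family, familyAt, if_pos rfl, ← restrict_tree, type]

theorem measurable_familyAt (n : ℕ) : Measurable fun ω => familyAt ω n := by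
  induction n with
  | zero => exact measurable_const
  | succ n ih =>
    refine measurable_pi_lambda _ fun u => ?_
    simp only [familyAt]
    split_ifs with h
    · refine measurable_apply_of_countable
        (c := fun ω : WeightedTreeSpace => (ofFamily (familyAt ω n)).restrict n)
        ((measurable_restrict n).comp (measurable_ofFamily.comp ih)) (countable_range_restrict n)
        (fun ω => ⟨_, rfl⟩) (g := fun t ω => ω.1 (u, ω.2 (n, t) u, t)) fun t => ?_
      refine measurable_apply_of_countable (c := fun ω : WeightedTreeSpace => ω.2 (n, t) u)
        ((measurable_pi_apply u).comp ((measurable_pi_apply (n, t)).comp measurable_snd))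
        Set.countable_univ (fun ω => Set.mem_univ _) (g := fun i ω => ω.1 (u, i, t)) fun i => ?_
      exact (measurable_pi_apply (u, i, t)).comp measurable_fst
    · exact (measurable_pi_apply u).comp ih

theorem measurable_tree : Measurable tree :=
  measurable_ofFamily.comp (measurable_pi_lambda _ fun u =>
    (measurable_pi_apply u).comp (measurable_familyAt (u.length + 1)))

theorem measurable_type (u : List ℕ) : Measurable fun ω => type ω u :=
  measurable_apply_of_countable
    (c := fun ω : WeightedTreeSpace => (tree ω).restrict u.length)
    ((measurable_restrict _).comp measurable_tree) (countable_range_restrict _)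
    (fun _ => ⟨_, rfl⟩) (g := fun t ω => ω.2 (u.length, t) u) fun t =>
      (measurable_pi_apply u).comp ((measurable_pi_apply (u.length, t)).comp measurable_snd)

/-- Which draws are used depends on the tree, but on this event the past is that of `t` and the
labels are deterministic, so the event is a rectangle. The bound `j` is `n` or `n + 1` according to
whether the types of generation `n` are included. -/
theorem setOf_restrict_eq_and_type_eq (t : MarkedTree) (s : List ℕ → ℕ) {n j : ℕ} (hnj : n ≤ j)
    (hjn : j ≤ n + 1) :
    {ω | (tree ω).restrict n = t.restrict n ∧ ∀ u ∈ t.nodes, u.length < j → type ω u = s u} =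
      {r : List ℕ × ℕ × MarkedTree → ℕ × Bool | ∀ u ∈ t.past n,
        r (u, s u, t.restrict u.length) = (t.numChildren u, t.mark u)} ×ˢ
      {S : ℕ × MarkedTree → List ℕ → ℕ | ∀ m ∈ Finset.range j, ∀ u ∈ t.level m,
        S (m, t.restrict m) u = s u} := by
  ext ω
  simp only [Set.mem_prod, Set.mem_ofPred_eq]
  constructor
  · rintro ⟨h, hT⟩
    refine ⟨fun u hu => ?_, fun m hm u hu => ?_⟩
    · have hx := restrict_ofFamily_eq_iff.mp h u hu
      obtain ⟨hu, hl⟩ := mem_past.mp hu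
      rw [← hx, family_eq, hT u hu (hl.trans_le hnj), restrict_eq_of_le hl.le h]
    · obtain ⟨hut, rfl⟩ := mem_level.mp hu
      have hm := Finset.mem_range.mp hm
      have hle : u.length ≤ n := by omega
      rw [← hT u hut hm, type, restrict_eq_of_le hle h]
  · rintro ⟨h1, h2⟩
    have hT : ∀ u ∈ t.nodes, u.length < j → (tree ω).restrict u.length = t.restrict u.length →
        type ω u = s u := by
      intro u hu hl h
      rw [type, h]
      exact h2 _ (Finset.mem_range.mpr hl) u (mem_level.mpr ⟨hu, rfl⟩)
    have h : ∀ m ≤ n, (tree ω).restrict m = t.restrict m := by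
      intro m
      induction m with
      | zero => exact fun _ => restrict_zero_eq _ _
      | succ m ih =>
        intro hm
        have ih := ih (by omega)
        rw [tree, restrict_ofFamily_eq_iff, past_succ, Finset.forall_mem_union]
        refine ⟨restrict_ofFamily_eq_iff.mp ih, fun u hu => ?_⟩
        obtain ⟨hut, rfl⟩ := mem_level.mp hu
        rw [family_eq, hT u hut (by omega) ih, ih]
        exact h1 u (mem_past.mpr ⟨hut, by omega⟩)
    exact ⟨h n le_rfl, fun u hu hl => hT u hu hl (h _ (by omega))⟩

variable (p : PMF ℕ) (q : ℕ → unitInterval) (ℓ : ℕ)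

/-- The law of the independent draws from which the weighted tree is built. -/
noncomputable def law : Measure WeightedTreeSpace :=
  (Measure.infinitePi fun a : List ℕ × ℕ × MarkedTree =>
    (typedPMF p q a.2.1 (a.2.2.mass a.1)).toMeasure).prod
  (Measure.infinitePi fun b : ℕ × MarkedTree => (typesPMF p q ℓ b.1 b.2).toMeasure)

instance : IsProbabilityMeasure (law p q ℓ) := by
  rw [law]; infer_instance

/-- The labels contain the vertex or the generation, so the draws involved are distinct and
independent. -/
theorem law_restrict_eq_and_type_eq (t : MarkedTree) (s : List ℕ → ℕ) {n j : ℕ} (hnj : n ≤ j)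
    (hjn : j ≤ n + 1) :
    law p q ℓ {ω | (tree ω).restrict n = t.restrict n ∧
        ∀ u ∈ t.nodes, u.length < j → type ω u = s u} =
      (∏ u ∈ t.past n, typedPMF p q (s u) (t.mass u) (t.numChildren u, t.mark u)) *
        ∏ m ∈ Finset.range j, (typesPMF p q ℓ m (t.restrict m)).toMeasure
          {s' | ∀ u ∈ t.level m, s' u = s u} := by
  classical
  rw [setOf_restrict_eq_and_type_eq t s hnj hjn, law, Measure.prod_prod]
  congr 1
  · let e : List ℕ → List ℕ × ℕ × MarkedTree := fun u => (u, s u, t.restrict u.length)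
    have he : Function.Injective e := fun u v h => (Prod.ext_iff.mp h).1
    have : {r : List ℕ × ℕ × MarkedTree → ℕ × Bool | ∀ u ∈ t.past n,
        r (u, s u, t.restrict u.length) = (t.numChildren u, t.mark u)} =
        Set.pi ((t.past n).image e) fun a => {(t.numChildren a.1, t.mark a.1)} := by
      ext r
      rw [Set.mem_pi, Finset.coe_image, Set.forall_mem_image]
      rfl
    rw [this, Measure.infinitePi_pi _ fun _ _ => measurableSet_singleton _,
      Finset.prod_image he.injOn]
    refine Finset.prod_congr rfl fun u _ => ?_
    rw [PMF.toMeasure_apply_singleton _ _ (measurableSet_singleton _)]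
    simp only [e]
    rw [mass_of_restrict_eq (restrict_restrict t u.length) le_rfl]
  · let e : ℕ → ℕ × MarkedTree := fun m => (m, t.restrict m)
    have he : Function.Injective e := fun u v h => (Prod.ext_iff.mp h).1
    have : {S : ℕ × MarkedTree → List ℕ → ℕ | ∀ m ∈ Finset.range j, ∀ u ∈ t.level m,
        S (m, t.restrict m) u = s u} =
        Set.pi ((Finset.range j).image e) fun b => {s' | ∀ u ∈ t.level b.1, s' u = s u} := by
      ext r
      rw [Set.mem_pi, Finset.coe_image, Set.forall_mem_image]
      rfl
    rw [this, Measure.infinitePi_pi _ fun _ _ => measurableSet_eqOn_finset _ _,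
      Finset.prod_image he.injOn]

variable {p q ℓ}

theorem typesPMF_restrict_eqOn (hpos : ∀ i ≤ ℓ, 0 < xi p q i) {n : ℕ} {t : MarkedTree}
    (hn : (t.level n).Nonempty) (s : List ℕ → ℕ) :
    (typesPMF p q ℓ n (t.restrict n)).toMeasure {s' | ∀ u ∈ t.level n, s' u = s u} =
      if ∑ u ∈ t.level n, s u = ℓ then ENNReal.ofReal (typeProb p q ℓ t n s) else 0 := by
  have hl : (t.restrict n).level n = t.level n :=
    level_of_restrict_eq le_rfl (restrict_restrict t n)
  have h := typesPMF_toMeasure_eqOn hpos (t := t.restrict n) (hl ▸ hn) s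
  rw [typeProb_congr (restrict_restrict t n) fun u _ => rfl, hl] at h
  exact h

/-- The property holds almost surely for each fixed past, hence simultaneously for the countably
many possible pasts, and in particular for the random one. -/
theorem ae_sum_type (hpos : ∀ i ≤ ℓ, 0 < xi p q i) (n : ℕ) :
    ∀ᵐ ω ∂(law p q ℓ), ((tree ω).level n).Nonempty →
      ∑ u ∈ (tree ω).level n, type ω u = ℓ := by
  have h : ∀ c ∈ Set.range (restrict n), ∀ᵐ ω ∂(law p q ℓ),
      (c.level n).Nonempty → ∑ u ∈ c.level n, ω.2 (n, c) u = ℓ := by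
    intro c _
    by_cases hc : (c.level n).Nonempty
    · have h1 := (measurePreserving_eval_infinitePi
        (fun b : ℕ × MarkedTree => (typesPMF p q ℓ b.1 b.2).toMeasure)
        (n, c)).quasiMeasurePreserving.ae (ae_typesPMF_sum_eq hpos hc)
      have h2 : ∀ᵐ ω ∂(law p q ℓ), ∑ u ∈ c.level n, ω.2 (n, c) u = ℓ :=
        Measure.quasiMeasurePreserving_snd.ae h1
      filter_upwards [h2] with ω hω _ using hω
    · exact Filter.Eventually.of_forall fun ω h => absurd h hc
  filter_upwards [(ae_ball_iff (countable_range_restrict n)).mpr h] with ω hω hne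
  have hl : ((tree ω).restrict n).level n = (tree ω).level n :=
    level_of_restrict_eq le_rfl (restrict_restrict _ n)
  have h := hω _ ⟨tree ω, rfl⟩ (hl ▸ hne)
  rw [hl] at h
  rw [← h]
  refine Finset.sum_congr rfl fun u hu => ?_
  rw [type, (mem_level.mp hu).2]

theorem isWeightedTree (hsub : ∑' k : ℕ, (k : ℝ≥0∞) * p k < 1)
    (hmom : ∑' k : ℕ, (k : ℝ≥0∞) ^ ℓ * p k < ∞)
    (hq : ∃ k : ℕ, 0 < (p k).toReal * (q k : ℝ)) :
    IsWeightedTree p q ℓ (law p q ℓ) tree type := by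
  have hpos : ∀ i ≤ ℓ, 0 < xi p q i := fun i hi => xi_pos hsub hmom hq hi
  refine ⟨measurable_tree, measurable_type, ?_, ae_sum_type hpos, fun n t s => ?_,
    fun n t s hn hs => ?_⟩
  · filter_upwards [ae_sum_type hpos 0] with ω hω
    simpa [level_zero] using hω
  · simp only [← Nat.lt_succ_iff (m := List.length _), Nat.succ_eq_add_one]
    rw [law_restrict_eq_and_type_eq p q ℓ t s le_rfl (Nat.le_succ _),
      law_restrict_eq_and_type_eq p q ℓ t s (Nat.le_succ _) le_rfl, past_succ,
      Finset.prod_union (disjoint_past_level t n), Finset.prod_range_succ]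
    by_cases hs : ∀ u ∈ t.level n, s u ≤ ℓ
    · have h : ∏ u ∈ t.level n, typedPMF p q (s u) (t.mass u) (t.numChildren u, t.mark u) =
          ∏ u ∈ t.level n,
            ENNReal.ofReal (typedLaw p q (s u) (t.mass u) (t.numChildren u) (t.mark u)) :=
        Finset.prod_congr rfl fun u hu =>
          typedPMF_apply hsub hmom hq (hs u hu) (t.mass_nonneg u) _ _
      rw [h]
      ring
    -- A type above `ℓ` has probability `0`, so both sides vanish. This case must be separated,
    -- since normalisation of `p_i` is only established for `i ≤ ℓ`.
    · push Not at hs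
      obtain ⟨u, hu, hlt⟩ := hs
      rw [typesPMF_restrict_eqOn hpos ⟨u, hu⟩, if_neg]
      · simp
      · exact fun hc => hlt.not_ge (le_of_sum_eq hc hu)
  · simp only [← Nat.lt_succ_iff (m := List.length _), Nat.succ_eq_add_one]
    rw [law_restrict_eq_and_type_eq p q ℓ t s (Nat.le_succ _) le_rfl,
      law_restrict_eq_and_type_eq p q ℓ t s le_rfl (Nat.le_succ _), Finset.prod_range_succ,
      typesPMF_restrict_eqOn hpos hn, if_pos hs, mul_assoc]

end WeightedTreeSpace

theorem mainTheorem2 (p : PMF ℕ) (q : ℕ → unitInterval) (ℓ : ℕ) (hℓ : 1 ≤ ℓ)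
    (hp : p 0 + p 1 < 1)
    (hsub : ∑' k : ℕ, (k : ℝ≥0∞) * p k < 1)
    (hmom : ∑' k : ℕ, (k : ℝ≥0∞) ^ ℓ * p k < ∞)
    (hq : ∃ k : ℕ, 0 < (p k).toReal * (q k : ℝ)) :
    (∃! Q : Measure MarkedTree, IsProbabilityMeasure Q ∧ IsGirsanovTransform p q ℓ Q) ∧
    (∃ (Ω : Type) (_ : MeasurableSpace Ω) (P : Measure Ω) (τ : Ω → MarkedTree)
      (T : Ω → List ℕ → ℕ), IsProbabilityMeasure P ∧ IsWeightedTree p q ℓ P τ T) ∧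
    (∀ Q : Measure MarkedTree, IsGirsanovTransform p q ℓ Q →
      ∀ (Ω : Type*) [MeasurableSpace Ω] (P : Measure Ω) [IsProbabilityMeasure P]
        (τ : Ω → MarkedTree) (T : Ω → List ℕ → ℕ),
        IsWeightedTree p q ℓ P τ T → P.map τ = Q) := by
  have hpos : ∀ i ≤ ℓ, 0 < xi p q i := fun i hi => xi_pos hsub hmom hq hi
  have W := WeightedTreeSpace.isWeightedTree hsub hmom hq
  have hprob : IsProbabilityMeasure ((WeightedTreeSpace.law p q ℓ).map WeightedTreeSpace.tree) :=
    Measure.isProbabilityMeasure_map W.measurable_tree.aemeasurable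
  refine ⟨⟨_, ⟨hprob, W.isGirsanovTransform_map hpos⟩, ?_⟩,
    ⟨WeightedTreeSpace, inferInstance, WeightedTreeSpace.law p q ℓ, WeightedTreeSpace.tree,
      WeightedTreeSpace.type, inferInstance, W⟩, ?_⟩
  · rintro Q ⟨_, hQ⟩
    exact hQ.eq (W.isGirsanovTransform_map hpos)
  · intro Q hQ Ω _ P _ τ T W'
    have := Measure.isProbabilityMeasure_map (μ := P) W'.measurable_tree.aemeasurable
    exact (W'.isGirsanovTransform_map hpos).eq hQ
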